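/- **Setting.** There are $K$ arms and $N\ge 1$ stochastic experts $\pi_1,\dots,\pi_N$; each $\pi_i(\cdot\mid x)$ is a conditional probability distribution on $\{1,\dots,K\}$ given a context $x\in\mathcal X$. In each round $t=1,\dots,T$ nature draws $(x_t,r_1(t),\dots,r_K(t))$ with $r_v(t)\in[0,1]$ from a fixed distribution, independently of the past; the learner invokes an expert $k(t)$, chosen from the past (and possibly independent randomization), plays an arm $v(t)\sim\pi_{k(t)}(\cdot\mid x_t)$ and observes $Y(t)=r_{v(t)}(t)$. Let $\mu_k$ be the expected reward in a round in which expert $k$ is invoked, $\mu^*=\max_k\mu_k$, $\Delta_k=\mu^*-\mu_k$, and let $0=\Delta_{(1)}\le\Delta_{(2)}\le\dots\le\Delta_{(N)}$ be the gaps in increasing order. The regret is $R(T)=\sum_{t=1}^T(\mu^*-\mu_{k(t)})$. **Divergences.** With $f_1(x)=xe^{x-1}-1$ put $$D_{f_1}(\pi_i\Vert\pi_j)=\mathbb E_{X,\,V\sim\pi_j(\cdot\mid X)}\Big[f_1\Big(\tfrac{\pi_i(V\mid X)}{\pi_j(V\mid X)}\Big)\Big],\qquad M_{ij}=1+\log\big(1+D_{f_1}(\pi_i\Vert\pi_j)\big),$$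 where $D_{f_1}(\pi_i\Vert\pi_j)=+\infty$ if $\pi_i(\cdot\mid X)\ll\pi_j(\cdot\mid X)$ does not hold almost surely. **Algorithm (D-UCB with the adaptively clipped estimator).** In round $1$ an arbitrary, possibly random, expert is invoked. In round $t\ge2$, $k(t)$ is a maximizer over $k$ of $U_k(t-1)$ (ties broken arbitrarily, without using the current round's context and rewards), where $U_k(t)=\hat\mu_k(t)+\tfrac32\beta_k(t)$. Here $n_j(t)$ is the number of rounds up to $t$ in which expert $j$ was invoked, $Z_k(t)=\sum_j n_j(t)/M_{kj}$, $\beta_k(t)\in(0,2)$ is the solution of $\beta/\log(2/\beta)=\sqrt{16\,t\log t}/Z_k(t)$ (with $\beta_k(1)=0$), and $$\hat\mu_k(t)=\frac1{Z_k(t)}\sum_{j=1}^N\ \sum_{s\le t:\,k(s)=j}\frac{Y(s)}{M_{kj}}\,w_{kj}(s)\,\mathbf 1\big\{w_{kj}(s)\le 2\log(2/\beta_k(t))M_{kj}\big\},\qquad w_{kj}(s)=\frac{\pi_k(v(s)\mid x_s)}{\pi_j(v(s)\mid x_s)}$$ (no clipping if $\beta_k(t)=0$). **Theorem.** There is a universal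 constant $C_1>0$ such that, whenever all $M_{ij}$ are finite, with $M=\max_{i,j}M_{ij}$ and $\gamma(x)=x^2/\log^2(6/x)$, for every $T$, $$\mathbb E[R(T)]\le\frac{C_1M^2\log^2(6/\Delta_{(N)})\log T}{\Delta_{(N)}}+\frac{\pi^2}{3}\sum_{i=2}^N\Delta_{(i)}+\sum_{k=2}^{N-1}\frac{C_1M^2\log^2(6/\Delta_{(k)})\log T}{\Delta_{(k)}}\Big(1-\frac{\gamma(\Delta_{(k)})}{\gamma(\Delta_{(k+1)})}\Big),$$ where terms with a zero gap $\Delta_{(N)}=0$ or $\Delta_{(k)}=0$ in the denominator are read as $0$. -/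

import Mathlib

open MeasureTheory ProbabilityTheory

noncomputable section

/-- A contextual bandit problem with `K` arms and `N` stochastic experts. In every round nature
draws a context together with the rewards in `[0,1]` of all arms from `nature`; an expert is a
conditional distribution of the arm given the context. -/
structure ExpertBandit (𝒳 : Type*) [MeasurableSpace 𝒳] (K N : ℕ) where
  nature : Measure (𝒳 × (Fin K → unitInterval))
  nature_prob : IsProbabilityMeasure nature
  expert : Fin N → Kernel 𝒳 (Fin K)
  expert_markov : ∀ i, IsMarkovKernel (expert i)

attribute [instance] ExpertBandit.nature_prob ExpertBandit.expert_markov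

/-- The conditional `f`-divergence `E_{q_{X,V}}[f(p(V|X)/q(V|X))]` for a context distribution `ρ`
and conditional distributions `p`, `q` of `V` given `X`, for a function `f` that is bounded below
on `[0,∞)` and grows superlinearly: it is `+∞` if `p(·|x) ≪ q(·|x)` fails for a non-null set of
contexts, or if the expectation is infinite. -/
def condFDiv {𝒳 : Type*} [MeasurableSpace 𝒳] {K : ℕ} (f : ℝ → ℝ) (ρ : Measure 𝒳)
    (p q : Kernel 𝒳 (Fin K)) : EReal :=
  open Classical in
  if (∀ᵐ x ∂ρ, p x ≪ q x) ∧
      Integrable (fun z : 𝒳 × Fin K => f ((p z.1).real {z.2} / (q z.1).real {z.2})) (ρ ⊗ₘ q) then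
    ((∫ z : 𝒳 × Fin K, f ((p z.1).real {z.2} / (q z.1).real {z.2}) ∂(ρ ⊗ₘ q) : ℝ) : EReal)
  else ⊤

/-- The positive solution `β` of `β / log (2/β) = c`. It exists, is unique and lies in `(0,2)` for
every `c > 0`; for `c = 0` we take the limiting value `0`. -/
def betaSol (c : ℝ) : ℝ :=
  open Classical in
  if h : ∃ b : ℝ, 0 < b ∧ b < 2 ∧ b / Real.log (2 / b) = c then h.choose else 0

/-- `γ(x) = x² / log²(6/x)`. -/
def gammaFn (x : ℝ) : ℝ := x ^ 2 / Real.log (6 / x) ^ 2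

/-- The number `n_j(t)` of rounds among `1, …, t` in which expert `j` was invoked, when expert
`e s` is invoked in round `s`. -/
def pullCount {N : ℕ} (e : ℕ → Fin N) (j : Fin N) (t : ℕ) : ℕ :=
  ((Finset.Icc 1 t).filter fun s => e s = j).card

namespace ExpertBandit

variable {𝒳 : Type*} [MeasurableSpace 𝒳] {K N : ℕ} (B : ExpertBandit 𝒳 K N)

/-- The probability `π_i(v|x)`. -/
def prob (i : Fin N) (v : Fin K) (x : 𝒳) : ℝ := (B.expert i x).real {v}

/-- The marginal distribution of the context. -/
def contextLaw : Measure 𝒳 := B.nature.map Prod.fst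

/-- The joint distribution of `((context, reward vector), arm)` in a round in which expert `j` is
used: the arm is drawn from `π_j(·|x)`, independently of the rewards given the context `x`. -/
def roundLaw (j : Fin N) : Measure ((𝒳 × (Fin K → unitInterval)) × Fin K) :=
  B.nature ⊗ₘ ((B.expert j).comap Prod.fst measurable_fst)

/-- The expected reward `μ_j` of expert `j`. -/
def meanReward (j : Fin N) : ℝ := ∫ z, (z.1.2 z.2 : ℝ) ∂(B.roundLaw j)

/-- `μ* = max_k μ_k`. -/
def bestMean : ℝ := ⨆ k, B.meanReward k

/-- The optimality gap `Δ_k = μ* - μ_k`. -/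
def gap (k : Fin N) : ℝ := B.bestMean - B.meanReward k

/-- `Δ_(k)` for `1 ≤ k ≤ N`: the `k`-th smallest gap, counted with multiplicity. -/
def orderedGap (k : ℕ) : ℝ :=
  if h : 1 ≤ k ∧ k ≤ N then B.gap (Tuple.sort B.gap ⟨k - 1, by omega⟩) else 0

/-- The log-divergence `M_ij = 1 + log (1 + D_f(π_i ‖ π_j))` with `f(x) = x exp(x-1) - 1`. -/
def logDiv (i j : Fin N) : EReal :=
  1 + ENNReal.log
    (1 + condFDiv (fun x => x * Real.exp (x - 1) - 1) B.contextLaw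
      (B.expert i) (B.expert j)).toENNReal

/-- `M_ij` as a real number (meaningful if it is finite). -/
def M (i j : Fin N) : ℝ := (B.logDiv i j).toReal

/-- `M = max_{i,j} M_ij`. -/
def maxM : ℝ := ⨆ p : Fin N × Fin N, B.M p.1 p.2

/-- `Z_k(t) = ∑_j n_j(t) / M_kj`. -/
def Z (e : ℕ → Fin N) (k : Fin N) (t : ℕ) : ℝ :=
  ∑ j : Fin N, (pullCount e j t : ℝ) / B.M k j

/-- `β_k(t)`, the solution of `β / log (2/β) = √(16 t log t) / Z_k(t)`. -/
def beta (e : ℕ → Fin N) (k : Fin N) (t : ℕ) : ℝ :=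
  betaSol (Real.sqrt (16 * t * Real.log t) / B.Z e k t)

/-- The clipped importance sampling estimator of `μ_k` from the contexts `x s`, invoked experts
`e s`, arms `v s` and rewards `y s` of the rounds `s = 1, …, t`, with bias parameter `ε`. The
clipping level `2 log(2/ε) M_kj` is infinite for `ε = 0`. -/
def clippedEst (x : ℕ → 𝒳) (e : ℕ → Fin N) (v : ℕ → Fin K) (y : ℕ → ℝ) (ε : ℝ)
    (k : Fin N) (t : ℕ) : ℝ :=
  open Classical in
  1 / B.Z e k t * ∑ j : Fin N, ∑ s ∈ (Finset.Icc 1 t).filter (fun s => e s = j),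
    1 / B.M k j * y s * (B.prob k (v s) (x s) / B.prob j (v s) (x s)) *
      (if ε = 0 ∨ B.prob k (v s) (x s) / B.prob j (v s) (x s) ≤ 2 * Real.log (2 / ε) * B.M k j
        then 1 else 0)

/-- The index `U_k(t) = μ̂_k(t) + (3/2) β_k(t)`, where the estimator `μ̂_k(t)` is clipped adaptively
with `ε(t) = β_k(t)`. -/
def ucb (x : ℕ → 𝒳) (e : ℕ → Fin N) (v : ℕ → Fin K) (y : ℕ → ℝ) (k : Fin N) (t : ℕ) : ℝ :=
  B.clippedEst x e v y (B.beta e k t) k t + 3 / 2 * B.beta e k t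

/-- The random variables `X t` (context), `R t` (rewards of all arms), `E t` (invoked expert) and
`V t` (arm played), `1 ≤ t ≤ T`, on a probability space `(Ω, P)` form a run of D-UCB with the
clipped estimator over `T` rounds. The σ-algebra `ℱ t` describes everything that happened in the
rounds `1, …, t`, together with any randomness used to choose the expert of round `t + 1` (the
choice of the first expert and the breaking of ties). -/
structure IsDUCBRun {Ω : Type*} [mΩ : MeasurableSpace Ω] (P : Measure Ω) (ℱ : Filtration ℕ mΩ)
    (T : ℕ) (X : ℕ → Ω → 𝒳) (R : ℕ → Ω → Fin K → unitInterval) (E : ℕ → Ω → Fin N)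
    (V : ℕ → Ω → Fin K) : Prop where
  expert_meas : ∀ t, 1 ≤ t → t ≤ T → Measurable[ℱ (t - 1)] (E t)
  context_meas : ∀ t, 1 ≤ t → t ≤ T → Measurable[ℱ t] (X t)
  reward_meas : ∀ t, 1 ≤ t → t ≤ T → Measurable[ℱ t] (R t)
  arm_meas : ∀ t, 1 ≤ t → t ≤ T → Measurable[ℱ t] (V t)
  /-- Given the past, and on the event that expert `j` is invoked in round `t`, the context and
  rewards are a fresh draw from nature and the arm is drawn from `π_j(·|X t)`. -/
  round_law : ∀ t, 1 ≤ t → t ≤ T → ∀ (j : Fin N) (A : Set Ω), MeasurableSet[ℱ (t - 1)] A →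
    (P.restrict (A ∩ {ω | E t ω = j})).map (fun ω => ((X t ω, R t ω), V t ω)) =
      P (A ∩ {ω | E t ω = j}) • B.roundLaw j
  /-- From the second round on, the expert with the largest index is invoked. -/
  argmax : ∀ t, 2 ≤ t → t ≤ T → ∀ᵐ ω ∂P, ∀ i : Fin N,
    B.ucb (fun s => X s ω) (fun s => E s ω) (fun s => V s ω)
        (fun s => (R s ω (V s ω) : ℝ)) i (t - 1) ≤
      B.ucb (fun s => X s ω) (fun s => E s ω) (fun s => V s ω)
        (fun s => (R s ω (V s ω) : ℝ)) (E t ω) (t - 1)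

/-- The regret `R(T) = ∑_{t=1}^T (μ* - μ_{k(t)})` when expert `e t` is invoked in round `t`. -/
def regret (e : ℕ → Fin N) (T : ℕ) : ℝ :=
  ∑ t ∈ Finset.Icc 1 T, (B.bestMean - B.meanReward (e t))

end ExpertBandit

end

-- The gain over ordinary UCB is that every round informs about every expert: one invocation of `j`
-- adds `1 / M k j ≥ 1 / maxM` to `Z k`, so `Z k t ≥ t / maxM` whatever was invoked (`le_Z`). All
-- widths therefore shrink with time itself, and an expert with positive gap `Δ` can be invoked, off
-- rare failure events, only up to about round `1024 M² log T / γ(Δ)`.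
--
-- Bias: finiteness of `M k j` controls the exponential moment `E[w exp (w - 1)] = exp (M - 1)` of
-- the importance weight, so clipping `w` at `L * M` loses at most `exp (1 - L)` of the mean
-- (`le_integral_clippedReward`). Fluctuation: clipped rewards lie in `[0, L]`, so Azuma-Hoeffding
-- bounds their centred sum by `2 L √(t log t)` up to probability `t⁻⁸`. With `L = 2 log (2 / β)`
-- the equation defining `β` says exactly `Z β = 2 L √(t log t)`, so the fluctuation of the
-- estimator is about `β`, and its bias is of order `β²`.
--
-- The difficulty is that `L` depends on the trajectory, while the concentration bound needs a fixed
-- level. Clipped rewards are monotone in the level, so `L` is sandwiched between neighbours of the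
-- grid `i / 12`, `1 ≤ i ≤ 12 t`, and a union bound over the grid still leaves failure probability
-- `t⁻²`. Off the failures the index lies between `μ` and `μ + 7/2 β` (`meanReward_le_ucb`,
-- `ucb_le`, the latter for `β ≤ 2/3`), so an invoked expert has `β ≥ Δ / 4`, which bounds `t`
-- (`le_of_gap_le_beta`).
--
-- The regret of round `t + 1` is thus at most the largest gap still active at `t`, plus failures
-- costing `2 (∑ Δ) / t²`. Summing the former over `t`, by parts over the ordered gaps, gives the
-- `γ`-ratio terms; the latter sum to `π² / 3 ∑ Δ`.

/-! ### The width equation and `γ` -/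

/-- The function `b ↦ b / log (2 / b)` is increasing on `(0, 2)`. -/
lemma div_log_two_div_mono {a b : ℝ} (ha : 0 < a) (hab : a ≤ b) (hb : b < 2) :
    a / Real.log (2 / a) ≤ b / Real.log (2 / b) := by
  have hb0 : 0 < b := ha.trans_le hab
  have h1 : 0 < Real.log (2 / b) := Real.log_pos (by rw [lt_div_iff₀ hb0]; linarith)
  have h2 : Real.log (2 / b) ≤ Real.log (2 / a) :=
    Real.log_le_log (by positivity) (by gcongr)
  exact div_le_div₀ hb0.le hab h1 h2

lemma exists_betaSol {c : ℝ} (hc : 0 < c) :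
    ∃ b : ℝ, 0 < b ∧ b < 2 ∧ b / Real.log (2 / b) = c := by
  -- Chosen so that `c * log (2 / a) = 2 > a`: the function `b - c * log (2 / b)` is negative at `a`
  -- and positive at `2`.
  set a : ℝ := 2 * Real.exp (-(2 / c)) with ha
  have ha0 : 0 < a := by positivity
  have hexp : Real.exp (-(2 / c)) < 1 := by
    rw [Real.exp_lt_one_iff]; have : 0 < 2 / c := by positivity
    linarith
  have ha2 : a < 2 := by rw [ha]; linarith
  have hcont : ContinuousOn (fun b : ℝ => b - c * Real.log (2 / b)) (Set.Icc a 2) := by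
    refine continuousOn_id.sub (continuousOn_const.mul (ContinuousOn.log ?_ ?_))
    · exact continuousOn_const.div continuousOn_id fun x hx => (ha0.trans_le hx.1).ne'
    · intro x hx
      have := ha0.trans_le hx.1
      positivity
  have hfa : a - c * Real.log (2 / a) < 0 := by
    have : Real.log (2 / a) = 2 / c := by
      rw [ha, show 2 / (2 * Real.exp (-(2 / c))) = Real.exp (2 / c) by
        rw [Real.exp_neg]; field_simp, Real.log_exp]
    rw [this, mul_div_cancel₀ _ hc.ne']
    linarith
  have hf2 : (0 : ℝ) < 2 - c * Real.log (2 / 2) := by simp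
  obtain ⟨b, hb, hb0⟩ := intermediate_value_Icc ha2.le hcont ⟨hfa.le, hf2.le⟩
  have hb0' : b - c * Real.log (2 / b) = 0 := hb0
  have hbpos : 0 < b := ha0.trans_le hb.1
  have hb2 : b < 2 := by
    rcases hb.2.lt_or_eq with h | h
    · exact h
    · subst h; linarith
  have hlog : 0 < Real.log (2 / b) := Real.log_pos (by rw [lt_div_iff₀ hbpos]; linarith)
  refine ⟨b, hbpos, hb2, ?_⟩
  rw [div_eq_iff hlog.ne']
  linarith

lemma betaSol_spec {c : ℝ} (hc : 0 < c) :
    0 < betaSol c ∧ betaSol c < 2 ∧ betaSol c / Real.log (2 / betaSol c) = c := by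
  have h := exists_betaSol hc
  rw [betaSol, dif_pos h]
  exact h.choose_spec

lemma gammaFn_pos {x : ℝ} (hx : 0 < x) (hx1 : x ≤ 1) : 0 < gammaFn x := by
  have : 0 < Real.log (6 / x) := Real.log_pos (by rw [lt_div_iff₀ hx]; linarith)
  unfold gammaFn
  positivity

lemma gammaFn_mono {x y : ℝ} (hx : 0 < x) (hxy : x ≤ y) (hy : y ≤ 1) :
    gammaFn x ≤ gammaFn y := by
  have hy0 : 0 < y := hx.trans_le hxy
  have h1 : 0 < Real.log (6 / y) := Real.log_pos (by rw [lt_div_iff₀ hy0]; linarith)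
  have h2 : Real.log (6 / y) ≤ Real.log (6 / x) := Real.log_le_log (by positivity) (by gcongr)
  unfold gammaFn
  gcongr

/-- If the width `betaSol c` is at least a quarter of the gap `d`, then `c` is not small. -/
lemma gammaFn_le_of_le_betaSol {c d : ℝ} (hc : 0 < c) (hd : 0 < d) (hd1 : d ≤ 1)
    (h : d / 4 ≤ betaSol c) : gammaFn d ≤ 64 * c ^ 2 := by
  obtain ⟨-, h2, h3⟩ := betaSol_spec hc
  have hlog6 : 0 < Real.log (6 / d) := Real.log_pos (by rw [lt_div_iff₀ hd]; linarith)
  have hlog8 : 0 < Real.log (2 / (d / 4)) :=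
    Real.log_pos (by rw [lt_div_iff₀ (by positivity)]; linarith)
  -- This is `8 / d ≤ 36 / d²`, valid since `d ≤ 1`. With the quarter in `d / 4` it produces the
  -- factor `8`, hence `64` after squaring.
  have hle : Real.log (2 / (d / 4)) ≤ 2 * Real.log (6 / d) := by
    rw [show 2 * Real.log (6 / d) = Real.log ((6 / d) ^ 2) by rw [Real.log_pow]; norm_num]
    refine Real.log_le_log (by positivity) ?_
    rw [div_pow, div_le_div_iff₀ (by positivity) (by positivity)]
    nlinarith
  have h4 := div_log_two_div_mono (by positivity) h h2
  rw [h3] at h4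
  have h5 : d / Real.log (6 / d) ≤ 8 * c := by
    rw [div_le_iff₀ hlog6]
    rw [div_le_iff₀ hlog8] at h4
    nlinarith
  have h6 : 0 ≤ d / Real.log (6 / d) := by positivity
  calc gammaFn d = (d / Real.log (6 / d)) ^ 2 := by rw [gammaFn, div_pow]
    _ ≤ (8 * c) ^ 2 := by gcongr
    _ = 64 * c ^ 2 := by ring

/-! ### Integration against a kernel into a finite set -/

section Discrete

variable {α : Type*} [MeasurableSpace α] {K : ℕ}

lemma measurable_real_singleton (q : Kernel α (Fin K)) (v : Fin K) :
    Measurable fun x => (q x).real {v} :=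
  (q.measurable_coe (measurableSet_singleton v)).ennreal_toReal

lemma sum_real_singleton (q : Kernel α (Fin K)) [IsMarkovKernel q] (x : α) :
    ∑ v, (q x).real {v} = 1 := by
  simp

lemma integral_compProd_fin {ρ : Measure α} [IsProbabilityMeasure ρ] (q : Kernel α (Fin K))
    [IsMarkovKernel q] {f : α × Fin K → ℝ} (hf : Integrable f (ρ ⊗ₘ q)) :
    ∫ z, f z ∂(ρ ⊗ₘ q) = ∫ x, ∑ v, (q x).real {v} * f (x, v) ∂ρ := by
  rw [Measure.integral_compProd hf]
  refine integral_congr_ae (.of_forall fun x => ?_)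
  simp only
  rw [integral_fintype Integrable.of_finite]
  simp

lemma integrable_compProd_fin {ρ : Measure α} [IsProbabilityMeasure ρ] (q : Kernel α (Fin K))
    [IsMarkovKernel q] {f : α × Fin K → ℝ} (hf : Integrable f (ρ ⊗ₘ q)) :
    Integrable (fun x => ∑ v, (q x).real {v} * f (x, v)) ρ := by
  have h : Integrable (fun x => ∫ y, f (x, y) ∂(q x)) ρ := by
    have := Integrable.integral_compProd (a := ()) (κ := Kernel.const Unit ρ)
      (η := Kernel.prodMkLeft Unit q) hf
    simpa using this
  refine h.congr (.of_forall fun x => ?_)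
  simp only
  rw [integral_fintype Integrable.of_finite]
  simp

end Discrete

/-! ### Importance weights, divergences and the bias of clipping -/

namespace ExpertBandit

variable {𝒳 : Type*} [MeasurableSpace 𝒳] {K N : ℕ} (B : ExpertBandit 𝒳 K N)

instance : IsProbabilityMeasure B.contextLaw :=
  Measure.isProbabilityMeasure_map measurable_fst.aemeasurable

instance (j : Fin N) : IsProbabilityMeasure (B.roundLaw j) := by
  unfold roundLaw; infer_instance

lemma measurable_prob (i : Fin N) (v : Fin K) : Measurable (B.prob i v) :=
  measurable_real_singleton (B.expert i) v

lemma prob_nonneg (i : Fin N) (v : Fin K) (x : 𝒳) : 0 ≤ B.prob i v x := measureReal_nonneg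

lemma sum_prob (i : Fin N) (x : 𝒳) : ∑ v, B.prob i v x = 1 := sum_real_singleton _ x

/-- The importance weight `π_i(v|x) / π_j(v|x)`. -/
noncomputable def weight (i j : Fin N) (v : Fin K) (x : 𝒳) : ℝ := B.prob i v x / B.prob j v x

lemma weight_nonneg (i j : Fin N) (v : Fin K) (x : 𝒳) : 0 ≤ B.weight i j v x :=
  div_nonneg (B.prob_nonneg ..) (B.prob_nonneg ..)

lemma measurable_weight (i j : Fin N) (v : Fin K) : Measurable (B.weight i j v) :=
  (B.measurable_prob i v).div (B.measurable_prob j v)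

/-- Where `π_j` vanishes the quotient is `0` by convention, so without absolute continuity only this
inequality survives. It suffices for the upper bound on the clipped mean; the bias bound needs
equality. -/
lemma prob_mul_weight_le (i j : Fin N) (v : Fin K) (x : 𝒳) :
    B.prob j v x * B.weight i j v x ≤ B.prob i v x := by
  rcases eq_or_ne (B.prob j v x) 0 with h | h
  · rw [h, zero_mul]; exact B.prob_nonneg ..
  · rw [weight, mul_div_cancel₀ _ h]

lemma prob_mul_weight {i j : Fin N} {v : Fin K} {x : 𝒳}
    (h : B.prob j v x = 0 → B.prob i v x = 0) :
    B.prob j v x * B.weight i j v x = B.prob i v x := by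
  rcases eq_or_ne (B.prob j v x) 0 with h0 | h0
  · rw [h0, zero_mul, h h0]
  · rw [weight, mul_div_cancel₀ _ h0]

lemma integral_roundLaw {j : Fin N} {f : (𝒳 × (Fin K → unitInterval)) × Fin K → ℝ}
    (hf : Integrable f (B.roundLaw j)) :
    ∫ z, f z ∂(B.roundLaw j) = ∫ y, ∑ v, B.prob j v y.1 * f (y, v) ∂B.nature :=
  integral_compProd_fin _ hf

lemma integrable_roundLaw {j : Fin N} {f : (𝒳 × (Fin K → unitInterval)) × Fin K → ℝ}
    (hf : Integrable f (B.roundLaw j)) :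
    Integrable (fun y => ∑ v, B.prob j v y.1 * f (y, v)) B.nature := by
  have := integrable_compProd_fin ((B.expert j).comap Prod.fst measurable_fst) hf
  simpa only [Kernel.comap_apply, prob] using this

lemma measurable_reward :
    Measurable fun z : (𝒳 × (Fin K → unitInterval)) × Fin K => (z.1.2 z.2 : ℝ) :=
  measurable_from_prod_countable_left fun v =>
    measurable_subtype_coe.comp ((measurable_pi_apply v).comp measurable_snd)

lemma integrable_reward (j : Fin N) :
    Integrable (fun z : (𝒳 × (Fin K → unitInterval)) × Fin K => (z.1.2 z.2 : ℝ)) (B.roundLaw j) :=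
  Integrable.of_mem_Icc 0 1 measurable_reward.aemeasurable
    (.of_forall fun z => (z.1.2 z.2).2)

lemma meanReward_nonneg (j : Fin N) : 0 ≤ B.meanReward j :=
  integral_nonneg fun z => (z.1.2 z.2).2.1

lemma meanReward_le_one (j : Fin N) : B.meanReward j ≤ 1 := by
  have := integral_mono (B.integrable_reward j) (integrable_const (1 : ℝ))
    (fun z => (z.1.2 z.2).2.2)
  simpa [meanReward] using this

/-- If `M_ij` is finite, then `π_i(·|X) ≪ π_j(·|X)` almost surely, and `exp (M_ij - 1)` is the
expectation of `w exp (w - 1)`, where `w` is the importance weight. -/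
lemma logDiv_facts {i j : Fin N} (h : B.logDiv i j ≠ ⊤) :
    (∀ᵐ y ∂B.nature, ∀ v, B.prob j v y.1 = 0 → B.prob i v y.1 = 0) ∧
    Integrable (fun y => ∑ v, B.prob j v y.1 *
      (B.weight i j v y.1 * Real.exp (B.weight i j v y.1 - 1))) B.nature ∧
    ∫ y, ∑ v, B.prob j v y.1 *
      (B.weight i j v y.1 * Real.exp (B.weight i j v y.1 - 1)) ∂B.nature = Real.exp (B.M i j - 1) ∧
    1 ≤ B.M i j := by
  have hD : condFDiv (fun x => x * Real.exp (x - 1) - 1) B.contextLaw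
      (B.expert i) (B.expert j) ≠ ⊤ := by
    intro hD
    apply h
    have h1 : (1 : EReal) + ⊤ = ⊤ := EReal.add_top_of_ne_bot (EReal.coe_ne_bot 1)
    rw [logDiv, hD, h1, EReal.toENNReal_top, ENNReal.log_top, h1]
  set D := condFDiv (fun x => x * Real.exp (x - 1) - 1) B.contextLaw
      (B.expert i) (B.expert j) with hDdef
  obtain ⟨⟨hac, hint⟩, hval⟩ : ((∀ᵐ x ∂B.contextLaw, B.expert i x ≪ B.expert j x) ∧
      Integrable (fun z : 𝒳 × Fin K => (fun x => x * Real.exp (x - 1) - 1)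
        ((B.expert i z.1).real {z.2} / (B.expert j z.1).real {z.2}))
        (B.contextLaw ⊗ₘ B.expert j)) ∧
      D = ((∫ z : 𝒳 × Fin K, (fun x => x * Real.exp (x - 1) - 1)
        ((B.expert i z.1).real {z.2} / (B.expert j z.1).real {z.2})
        ∂(B.contextLaw ⊗ₘ B.expert j) : ℝ) : EReal) := by
    rw [condFDiv] at hDdef
    split_ifs at hDdef with hc
    · exact ⟨hc, hDdef⟩
    · exact absurd hDdef hD
  have hac' : ∀ᵐ y ∂B.nature, ∀ v, B.prob j v y.1 = 0 → B.prob i v y.1 = 0 := by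
    filter_upwards [ae_of_ae_map measurable_fst.aemeasurable hac] with y hy v hv
    rw [prob, measureReal_eq_zero_iff] at hv ⊢
    exact hy hv
  set g : 𝒳 × Fin K → ℝ := fun z => B.weight i j z.2 z.1 * Real.exp (B.weight i j z.2 z.1 - 1)
  have hg : Integrable g (B.contextLaw ⊗ₘ B.expert j) :=
    (hint.add (integrable_const 1)).congr (.of_forall fun z => by
      simp [g, weight, prob])
  have hgm : Measurable fun x => ∑ v, B.prob j v x * g (x, v) :=
    Finset.measurable_fun_sum _ fun v _ => (B.measurable_prob j v).mul
      ((B.measurable_weight i j v).mul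
        (Real.measurable_exp.comp ((B.measurable_weight i j v).sub_const 1)))
  have hI1 : Integrable (fun y : 𝒳 × (Fin K → unitInterval) => ∑ v, B.prob j v y.1 * g (y.1, v))
      B.nature :=
    (integrable_map_measure hgm.aestronglyMeasurable measurable_fst.aemeasurable).1
      (integrable_compProd_fin (ρ := B.contextLaw) (B.expert j) hg)
  set A := ∫ y : 𝒳 × (Fin K → unitInterval), ∑ v, B.prob j v y.1 * g (y.1, v) ∂B.nature with hA
  have hgA : ∫ z, g z ∂(B.contextLaw ⊗ₘ B.expert j) = A := by
    rw [integral_compProd_fin _ hg]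
    exact integral_map measurable_fst.aemeasurable hgm.aestronglyMeasurable
  have hDA : D = ((A - 1 : ℝ) : EReal) := by
    rw [hval, ← hgA]
    congr 1
    have := integral_sub hg (integrable_const (1 : ℝ))
    simp only [integral_const, probReal_univ, smul_eq_mul, mul_one] at this
    rw [← this]
    rfl
  -- Pointwise `w exp (w - 1) ≥ w² ≥ 2 w - 1`, and `2 w - 1` has mean `1` under `π_j` by absolute
  -- continuity. Hence the divergence `A - 1` is nonnegative and `M ≥ 1`.
  have hA1 : 1 ≤ A := by
    have : ∫ _y : 𝒳 × (Fin K → unitInterval), (1 : ℝ) ∂B.nature ≤ A := by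
      refine integral_mono_ae (integrable_const _) hI1 ?_
      filter_upwards [hac'] with y hy
      calc (1 : ℝ) = ∑ v, (2 * B.prob i v y.1 - B.prob j v y.1) := by
            rw [Finset.sum_sub_distrib, ← Finset.mul_sum, sum_prob, sum_prob]; norm_num
        _ ≤ ∑ v, B.prob j v y.1 * g (y.1, v) := by
            refine Finset.sum_le_sum fun v _ => ?_
            rw [← B.prob_mul_weight (hy v)]
            have h0 := B.weight_nonneg i j v y.1
            have h1 : B.weight i j v y.1 ≤ Real.exp (B.weight i j v y.1 - 1) := by
              linarith [Real.add_one_le_exp (B.weight i j v y.1 - 1)]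
            have h2 : 2 * B.weight i j v y.1 - 1 ≤ g (y.1, v) := by
              simp only [g]
              nlinarith [sq_nonneg (B.weight i j v y.1 - 1)]
            nlinarith [B.prob_nonneg j v y.1]
    simpa using this
  have hM : B.M i j = 1 + Real.log A := by
    rw [M, logDiv, ← hDdef, hDA]
    have h1 : (1 + ((A - 1 : ℝ) : EReal)) = ((A : ℝ) : EReal) := by
      rw [← EReal.coe_one, ← EReal.coe_add]; congr 1; ring
    rw [h1, EReal.toENNReal_of_ne_top (EReal.coe_ne_top _), EReal.toReal_coe,
      ENNReal.log_ofReal_of_pos (by linarith), ← EReal.coe_one, ← EReal.coe_add, EReal.toReal_coe]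
  refine ⟨hac', hI1, ?_, ?_⟩
  · rw [hM, add_sub_cancel_left, Real.exp_log (by linarith)]
  · rw [hM]; linarith [Real.log_nonneg hA1]

/-- The reward of a round in which expert `j` is invoked, weighted for the estimation of `μ_k` and
clipped at level `L`. -/
noncomputable def clippedReward (k : Fin N) (L : ℝ) (j : Fin N)
    (z : (𝒳 × (Fin K → unitInterval)) × Fin K) : ℝ :=
  open Classical in
  1 / B.M k j * (z.1.2 z.2 : ℝ) * B.weight k j z.2 z.1.1 *
    (if B.weight k j z.2 z.1.1 ≤ L * B.M k j then 1 else 0)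

lemma measurable_clippedReward (k : Fin N) (L : ℝ) (j : Fin N) :
    Measurable (B.clippedReward k L j) := by
  have hw : Measurable fun z : (𝒳 × (Fin K → unitInterval)) × Fin K => B.weight k j z.2 z.1.1 :=
    measurable_from_prod_countable_left fun v => (B.measurable_weight k j v).comp measurable_fst
  exact ((measurable_reward.const_mul _).mul hw).mul
    (Measurable.ite (measurableSet_le hw measurable_const) measurable_const measurable_const)

lemma clippedReward_nonneg {k j : Fin N} (hM : 1 ≤ B.M k j) (L : ℝ)
    (z : (𝒳 × (Fin K → unitInterval)) × Fin K) : 0 ≤ B.clippedReward k L j z := by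
  have h1 := (z.1.2 z.2).2.1
  have h2 := B.weight_nonneg k j z.2 z.1.1
  unfold clippedReward
  split_ifs
  · positivity
  · simp

lemma clippedReward_le {k j : Fin N} (hM : 1 ≤ B.M k j) {L : ℝ} (hL : 0 ≤ L)
    (z : (𝒳 × (Fin K → unitInterval)) × Fin K) : B.clippedReward k L j z ≤ L := by
  have h1 := (z.1.2 z.2).2
  have h2 := B.weight_nonneg k j z.2 z.1.1
  have hM0 : 0 < B.M k j := by linarith
  unfold clippedReward
  split_ifs with h
  · rw [mul_one]
    calc 1 / B.M k j * (z.1.2 z.2 : ℝ) * B.weight k j z.2 z.1.1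
        ≤ 1 / B.M k j * 1 * (L * B.M k j) := by
          gcongr
          exact h1.2
      _ = L := by field_simp
  · simpa using hL

lemma clippedReward_mono {k j : Fin N} (hM : 1 ≤ B.M k j) {L L' : ℝ} (h : L ≤ L')
    (z : (𝒳 × (Fin K → unitInterval)) × Fin K) :
    B.clippedReward k L j z ≤ B.clippedReward k L' j z := by
  have h1 := (z.1.2 z.2).2.1
  have h2 := B.weight_nonneg k j z.2 z.1.1
  have hM0 : 0 < B.M k j := by linarith
  unfold clippedReward
  refine mul_le_mul_of_nonneg_left ?_ (by positivity)
  split_ifs with h3 h4 h4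
  · rfl
  · exact absurd (h3.trans (by gcongr)) h4
  · norm_num
  · rfl

lemma integrable_clippedReward {k j : Fin N} (hM : 1 ≤ B.M k j) {L : ℝ} (hL : 0 ≤ L) :
    Integrable (B.clippedReward k L j) (B.roundLaw j) :=
  Integrable.of_mem_Icc 0 L (B.measurable_clippedReward k L j).aemeasurable
    (.of_forall fun z => ⟨B.clippedReward_nonneg hM L z, B.clippedReward_le hM hL z⟩)

/-- The clipped estimator does not overestimate in expectation. -/
lemma integral_clippedReward_le {k j : Fin N} (hM : 1 ≤ B.M k j) {L : ℝ} (hL : 0 ≤ L) :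
    ∫ z, B.clippedReward k L j z ∂(B.roundLaw j) ≤ B.meanReward k / B.M k j := by
  have hM0 : 0 < B.M k j := by linarith
  rw [meanReward, B.integral_roundLaw (B.integrable_clippedReward hM hL),
    B.integral_roundLaw (B.integrable_reward k), ← integral_div]
  refine integral_mono (B.integrable_roundLaw (B.integrable_clippedReward hM hL))
    ((B.integrable_roundLaw (B.integrable_reward k)).div_const _) fun y => ?_
  simp only
  rw [Finset.sum_div]
  refine Finset.sum_le_sum fun v _ => ?_
  have h1 := (y.2 v).2.1
  have h3 := B.prob_mul_weight_le k j v y.1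
  have h4 := B.prob_nonneg k v y.1
  unfold clippedReward
  simp only
  split_ifs
  · calc B.prob j v y.1 * (1 / B.M k j * (y.2 v : ℝ) * B.weight k j v y.1 * 1)
        = (B.prob j v y.1 * B.weight k j v y.1) * (y.2 v : ℝ) / B.M k j := by ring
      _ ≤ _ := by gcongr
  · rw [mul_zero, mul_zero]; positivity

/-- The bias of the clipped estimator is exponentially small in the clipping level. -/
lemma le_integral_clippedReward {k j : Fin N} (h : B.logDiv k j ≠ ⊤) {L : ℝ} (hL : 1 ≤ L) :
    (B.meanReward k - Real.exp (1 - L)) / B.M k j ≤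
      ∫ z, B.clippedReward k L j z ∂(B.roundLaw j) := by
  obtain ⟨hac, hI, hA, hM⟩ := B.logDiv_facts h
  have hL0 : 0 ≤ L := by linarith
  have hM0 : 0 < B.M k j := by linarith
  have hi1 := B.integrable_roundLaw (B.integrable_reward k)
  have hi2 := B.integrable_roundLaw (B.integrable_clippedReward hM hL0)
  -- The exponents add up to `-(L - 1) M`, which is at most `1 - L` because `M ≥ 1` and `L ≥ 1`.
  have hexp : Real.exp (1 - L * B.M k j) * Real.exp (B.M k j - 1) ≤ Real.exp (1 - L) := by
    rw [← Real.exp_add]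
    gcongr
    nlinarith
  have key : (B.meanReward k - Real.exp (1 - L * B.M k j) * Real.exp (B.M k j - 1)) / B.M k j ≤
      ∫ z, B.clippedReward k L j z ∂(B.roundLaw j) := by
    rw [← hA, meanReward, B.integral_roundLaw (B.integrable_clippedReward hM hL0),
      B.integral_roundLaw (B.integrable_reward k), ← integral_const_mul,
      ← integral_sub hi1 (hI.const_mul _), ← integral_div]
    refine integral_mono_ae ((hi1.sub (hI.const_mul _)).div_const _) hi2 ?_
    filter_upwards [hac] with y hy
    rw [Finset.mul_sum, ← Finset.sum_sub_distrib, Finset.sum_div]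
    refine Finset.sum_le_sum fun v _ => ?_
    have h1 := (y.2 v).2
    have h4 := B.prob_nonneg j v y.1
    have h5 := B.weight_nonneg k j v y.1
    rw [← B.prob_mul_weight (hy v), div_le_iff₀ hM0]
    unfold clippedReward
    simp only
    split_ifs with hw
    · have : 0 ≤ Real.exp (1 - L * B.M k j) * (B.prob j v y.1 *
        (B.weight k j v y.1 * Real.exp (B.weight k j v y.1 - 1))) := by positivity
      have h6 : B.prob j v y.1 * (1 / B.M k j * (y.2 v : ℝ) * B.weight k j v y.1 * 1) * B.M k j =
          B.prob j v y.1 * B.weight k j v y.1 * (y.2 v : ℝ) := by field_simp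
      rw [h6]
      linarith
    -- Chernoff step: past the level, `w > L M`, so the factor `exp (w - L M)` dominates the
    -- indicator of being clipped.
    · have h7 : 1 ≤ Real.exp (1 - L * B.M k j) * Real.exp (B.weight k j v y.1 - 1) := by
        rw [← Real.exp_add]
        exact Real.one_le_exp (by linarith)
      have h8 : 0 ≤ B.prob j v y.1 * B.weight k j v y.1 := by positivity
      have h9 : B.prob j v y.1 * B.weight k j v y.1 * (y.2 v : ℝ) ≤
          B.prob j v y.1 * B.weight k j v y.1 *
            (Real.exp (1 - L * B.M k j) * Real.exp (B.weight k j v y.1 - 1)) :=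
        mul_le_mul_of_nonneg_left (h1.2.trans h7) h8
      simp only [mul_zero, zero_mul]
      linarith
  refine le_trans ?_ key
  gcongr

end ExpertBandit

/-! ### Concentration along an adaptive run -/

/-- Hoeffding's lemma as a bound on a Lebesgue integral. -/
lemma lintegral_exp_mul_sub_integral_le {α : Type*} [MeasurableSpace α] {ν : Measure α}
    [IsProbabilityMeasure ν] {f : α → ℝ} (hf : Measurable f) {a b : ℝ}
    (h : ∀ z, f z ∈ Set.Icc a b) (l : ℝ) :
    ∫⁻ z, ENNReal.ofReal (Real.exp (l * (f z - ∫ y, f y ∂ν))) ∂ν ≤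
      ENNReal.ofReal (Real.exp (l ^ 2 * (b - a) ^ 2 / 8)) := by
  have H := hasSubgaussianMGF_of_mem_Icc (μ := ν) hf.aemeasurable (.of_forall h)
  rw [← ofReal_integral_eq_lintegral_ofReal (H.integrable_exp_mul l)
    (.of_forall fun z => (Real.exp_pos _).le)]
  refine ENNReal.ofReal_le_ofReal ((H.mgf_le l).trans_eq ?_)
  congr 1
  push_cast
  rw [Real.norm_eq_abs, div_pow, sq_abs]
  ring

namespace ExpertBandit

variable {𝒳 : Type*} [MeasurableSpace 𝒳] {K N : ℕ} {B : ExpertBandit 𝒳 K N}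
  {Ω : Type*} [mΩ : MeasurableSpace Ω] {P : Measure Ω} {ℱ : Filtration ℕ mΩ} {T : ℕ}
  {X : ℕ → Ω → 𝒳} {R : ℕ → Ω → Fin K → unitInterval} {E : ℕ → Ω → Fin N} {V : ℕ → Ω → Fin K}

namespace IsDUCBRun

lemma measurable_round (h : B.IsDUCBRun P ℱ T X R E V) {t : ℕ} (h1 : 1 ≤ t) (h2 : t ≤ T) :
    Measurable[ℱ t] fun ω => ((X t ω, R t ω), V t ω) :=
  ((h.context_meas t h1 h2).prodMk (h.reward_meas t h1 h2)).prodMk (h.arm_meas t h1 h2)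

lemma measurable_expert (h : B.IsDUCBRun P ℱ T X R E V) {t : ℕ} (h1 : 1 ≤ t) (h2 : t ≤ T) :
    Measurable (E t) :=
  (h.expert_meas t h1 h2).mono (ℱ.le _) le_rfl

lemma measurable_comp_round (h : B.IsDUCBRun P ℱ T X R E V) {β : Type*} [MeasurableSpace β]
    {φ : Fin N → (𝒳 × (Fin K → unitInterval)) × Fin K → β} (hφ : ∀ j, Measurable (φ j))
    {t : ℕ} (h1 : 1 ≤ t) (h2 : t ≤ T) :
    Measurable[ℱ t] fun ω => φ (E t ω) ((X t ω, R t ω), V t ω) := by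
  have hφ' : Measurable fun p : Fin N × ((𝒳 × (Fin K → unitInterval)) × Fin K) => φ p.1 p.2 :=
    measurable_from_prod_countable_right hφ
  exact hφ'.comp ((((h.expert_meas t h1 h2).mono (ℱ.mono (Nat.sub_le t 1)) le_rfl)).prodMk
    (h.measurable_round h1 h2))

/-- Given that expert `j` is invoked in round `t`, the observations of round `t` are independent
of the past. -/
lemma setLIntegral_mul (h : B.IsDUCBRun P ℱ T X R E V) {t : ℕ} (h1 : 1 ≤ t) (h2 : t ≤ T)
    (j : Fin N) {φ : (𝒳 × (Fin K → unitInterval)) × Fin K → ENNReal} (hφ : Measurable φ)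
    {g : Ω → ENNReal} (hg : Measurable[ℱ (t - 1)] g) :
    ∫⁻ ω in {ω | E t ω = j}, g ω * φ ((X t ω, R t ω), V t ω) ∂P =
      (∫⁻ ω in {ω | E t ω = j}, g ω ∂P) * ∫⁻ z, φ z ∂(B.roundLaw j) := by
  have hle := ℱ.le (t - 1)
  have hround : Measurable fun ω => ((X t ω, R t ω), V t ω) :=
    (h.measurable_round h1 h2).mono (ℱ.le t) le_rfl
  have hφr : Measurable fun ω => φ ((X t ω, R t ω), V t ω) := hφ.comp hround
  -- The case of an indicator of a past event is `round_law`; sums and monotone limits extend it to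
  -- every past-measurable `g`.
  refine Measurable.ennreal_induction (mα := ℱ (t - 1)) (motive := fun g =>
    ∫⁻ ω in {ω | E t ω = j}, g ω * φ ((X t ω, R t ω), V t ω) ∂P =
      (∫⁻ ω in {ω | E t ω = j}, g ω ∂P) * ∫⁻ z, φ z ∂(B.roundLaw j)) ?_ ?_ ?_ hg
  · intro c A hA
    have hA' : MeasurableSet A := hle _ hA
    have hset : ∀ ω, A.indicator (fun _ => c) ω * φ ((X t ω, R t ω), V t ω) =
        A.indicator (fun ω => c * φ ((X t ω, R t ω), V t ω)) ω := by
      intro ω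
      by_cases hω : ω ∈ A <;> simp [hω]
    simp_rw [hset]
    rw [lintegral_indicator hA', lintegral_indicator hA', Measure.restrict_restrict hA',
      lintegral_const_mul _ hφr, ← lintegral_map hφ hround, h.round_law t h1 h2 j A hA,
      lintegral_smul_measure]
    simp [mul_assoc]
  · intro f g _ hf hg hf' hg'
    have hf0 : Measurable f := hf.mono hle le_rfl
    have hg0 : Measurable g := hg.mono hle le_rfl
    simp only [Pi.add_apply, add_mul]
    have hfφ : Measurable fun ω => f ω * φ ((X t ω, R t ω), V t ω) := hf0.mul hφr
    rw [lintegral_add_left hfφ, lintegral_add_left hf0, hf', hg', add_mul]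
  · intro f hf hmono hf'
    have hf0 : ∀ n, Measurable (f n) := fun n => (hf n).mono hle le_rfl
    simp only [ENNReal.iSup_mul]
    have hfφ : ∀ n, Measurable fun ω => f n ω * φ ((X t ω, R t ω), V t ω) :=
      fun n => (hf0 n).mul hφr
    have hmono' : Monotone fun n ω => f n ω * φ ((X t ω, R t ω), V t ω) :=
      fun m n hmn ω => mul_le_mul_left (hmono hmn ω) _
    rw [lintegral_iSup hfφ hmono', lintegral_iSup hf0 hmono, ENNReal.iSup_mul]
    simp_rw [hf']

/-- If `∫⁻ φ_j ≤ κ` under the law of a round with expert `j`, then the product of the `φ`'s over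
`t` rounds has expectation at most `κ ^ t`. -/
lemma lintegral_prod_le [IsProbabilityMeasure P] (h : B.IsDUCBRun P ℱ T X R E V)
    {φ : Fin N → (𝒳 × (Fin K → unitInterval)) × Fin K → ENNReal} (hφ : ∀ j, Measurable (φ j))
    {κ : ENNReal} (hκ : ∀ j, ∫⁻ z, φ j z ∂(B.roundLaw j) ≤ κ) {t : ℕ} (ht : t ≤ T) :
    ∫⁻ ω, ∏ s ∈ Finset.Icc 1 t, φ (E s ω) ((X s ω, R s ω), V s ω) ∂P ≤ κ ^ t := by
  induction t with
  | zero => simp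
  | succ t ih =>
    have h1 : 1 ≤ t + 1 := by omega
    set G : Ω → ENNReal := fun ω => ∏ s ∈ Finset.Icc 1 t, φ (E s ω) ((X s ω, R s ω), V s ω)
    have hG : Measurable[ℱ (t + 1 - 1)] G := by
      refine Finset.measurable_fun_prod _ fun s hs => ?_
      rw [Finset.mem_Icc] at hs
      exact (h.measurable_comp_round hφ hs.1 (by omega)).mono (ℱ.mono (by omega)) le_rfl
    have hE := h.measurable_expert h1 ht
    have hsplit : ∀ f : Ω → ENNReal, ∫⁻ ω, f ω ∂P =
        ∑ j, ∫⁻ ω in {ω | E (t + 1) ω = j}, f ω ∂P := by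
      intro f
      have hU : (⋃ j ∈ (Finset.univ : Finset (Fin N)), {ω | E (t + 1) ω = j}) = Set.univ := by
        ext ω; simp
      have hm : ∀ j ∈ (Finset.univ : Finset (Fin N)), MeasurableSet {ω | E (t + 1) ω = j} :=
        fun j _ => hE (measurableSet_singleton j)
      rw [← lintegral_biUnion_finset _ hm, hU, Measure.restrict_univ]
      intro i _ j _ hij
      refine Set.disjoint_left.2 fun ω hi hj => hij ?_
      rw [← show E (t + 1) ω = i from hi]
      exact hj
    calc ∫⁻ ω, ∏ s ∈ Finset.Icc 1 (t + 1), φ (E s ω) ((X s ω, R s ω), V s ω) ∂P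
        = ∑ j, ∫⁻ ω in {ω | E (t + 1) ω = j},
            G ω * φ j ((X (t + 1) ω, R (t + 1) ω), V (t + 1) ω) ∂P := by
          rw [hsplit]
          refine Finset.sum_congr rfl fun j _ => ?_
          refine setLIntegral_congr_fun (hE (measurableSet_singleton j)) fun ω hω => ?_
          have hω' : E (t + 1) ω = j := hω
          simp only [G]
          rw [Finset.prod_Icc_succ_top h1, hω']
      _ ≤ ∑ j, (∫⁻ ω in {ω | E (t + 1) ω = j}, G ω ∂P) * κ := by
          refine Finset.sum_le_sum fun j _ => ?_
          rw [h.setLIntegral_mul h1 ht j (hφ j) hG]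
          gcongr
          exact hκ j
      _ = (∫⁻ ω, G ω ∂P) * κ := by rw [← Finset.sum_mul, ← hsplit]
      _ ≤ κ ^ t * κ := by gcongr; exact ih (by omega)
      _ = κ ^ (t + 1) := (pow_succ _ _).symm

/-- The Azuma-Hoeffding inequality along a run. -/
lemma measure_sum_sub_ge_le [IsProbabilityMeasure P] (h : B.IsDUCBRun P ℱ T X R E V)
    {f : Fin N → (𝒳 × (Fin K → unitInterval)) × Fin K → ℝ} (hf : ∀ j, Measurable (f j))
    {a b : ℝ} (hab : a < b) (hfab : ∀ j z, f j z ∈ Set.Icc a b) {t : ℕ} (ht0 : 1 ≤ t) (ht : t ≤ T)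
    (ε : ℝ) (hε : 0 ≤ ε) :
    P {ω | ε ≤ ∑ s ∈ Finset.Icc 1 t, (f (E s ω) ((X s ω, R s ω), V s ω) -
      ∫ z, f (E s ω) z ∂(B.roundLaw (E s ω)))} ≤
      ENNReal.ofReal (Real.exp (-(2 * ε ^ 2 / (t * (b - a) ^ 2)))) := by
  have ht' : (0 : ℝ) < t := by exact_mod_cast ht0
  have hab' : 0 < b - a := by linarith
  -- The minimizer of the Chernoff exponent `t l² (b - a)² / 8 - l ε`.
  set l : ℝ := 4 * ε / (t * (b - a) ^ 2) with hl
  have hl0 : 0 ≤ l := by positivity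
  set φ : Fin N → (𝒳 × (Fin K → unitInterval)) × Fin K → ENNReal := fun j z =>
    ENNReal.ofReal (Real.exp (l * (f j z - ∫ y, f j y ∂(B.roundLaw j)))) with hφdef
  have hφ : ∀ j, Measurable (φ j) := fun j =>
    (Real.measurable_exp.comp (((hf j).sub_const _).const_mul l)).ennreal_ofReal
  have hbound := h.lintegral_prod_le hφ
    (fun j => lintegral_exp_mul_sub_integral_le (hf j) (hfab j) l) ht
  have hprod : ∀ ω, ∏ s ∈ Finset.Icc 1 t, φ (E s ω) ((X s ω, R s ω), V s ω) =
      ENNReal.ofReal (Real.exp (l * ∑ s ∈ Finset.Icc 1 t,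
        (f (E s ω) ((X s ω, R s ω), V s ω) - ∫ z, f (E s ω) z ∂(B.roundLaw (E s ω))))) := by
    intro ω
    rw [Finset.mul_sum, Real.exp_sum, ENNReal.ofReal_prod_of_nonneg fun s _ => (Real.exp_pos _).le]
  have hmeas : Measurable fun ω => ∏ s ∈ Finset.Icc 1 t, φ (E s ω) ((X s ω, R s ω), V s ω) := by
    refine Finset.measurable_fun_prod _ fun s hs => ?_
    rw [Finset.mem_Icc] at hs
    exact (h.measurable_comp_round hφ hs.1 (by omega)).mono (ℱ.le s) le_rfl
  have hexp0 : ENNReal.ofReal (Real.exp (l * ε)) ≠ 0 := by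
    simpa using Real.exp_pos (l * ε)
  calc _ ≤ P {ω | ENNReal.ofReal (Real.exp (l * ε)) ≤
          ∏ s ∈ Finset.Icc 1 t, φ (E s ω) ((X s ω, R s ω), V s ω)} := by
        refine measure_mono fun ω hω => ?_
        simp only [Set.mem_ofPred_eq] at hω ⊢
        rw [hprod]
        gcongr
    _ ≤ _ := meas_ge_le_lintegral_div hmeas.aemeasurable hexp0 ENNReal.ofReal_ne_top
    _ ≤ ENNReal.ofReal (Real.exp (l ^ 2 * (b - a) ^ 2 / 8)) ^ t /
          ENNReal.ofReal (Real.exp (l * ε)) := by gcongr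
    _ = ENNReal.ofReal (Real.exp (-(2 * ε ^ 2 / (t * (b - a) ^ 2)))) := by
        rw [← ENNReal.ofReal_pow (Real.exp_pos _).le, ← ENNReal.ofReal_div_of_pos (Real.exp_pos _),
          ← Real.exp_nat_mul, ← Real.exp_sub]
        congr 2
        rw [hl]
        field_simp
        ring

end IsDUCBRun

end ExpertBandit

/-! ### Confidence bounds on a fixed trajectory -/

namespace ExpertBandit

variable {𝒳 : Type*} [MeasurableSpace 𝒳] {K N : ℕ} (B : ExpertBandit 𝒳 K N)

lemma Z_eq_sum (e : ℕ → Fin N) (k : Fin N) (t : ℕ) :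
    B.Z e k t = ∑ s ∈ Finset.Icc 1 t, 1 / B.M k (e s) := by
  rw [Z, ← Finset.sum_fiberwise (Finset.Icc 1 t) e]
  refine Finset.sum_congr rfl fun j _ => ?_
  rw [Finset.sum_congr rfl (g := fun _ => 1 / B.M k j) fun s hs => by
    rw [(Finset.mem_filter.1 hs).2], Finset.sum_const, pullCount, nsmul_eq_mul]
  ring

lemma M_le_maxM (i j : Fin N) : B.M i j ≤ B.maxM :=
  le_ciSup (f := fun p : Fin N × Fin N => B.M p.1 p.2) (Set.finite_range _).bddAbove (i, j)

lemma Z_le (hM : ∀ i j, 1 ≤ B.M i j) (e : ℕ → Fin N) (k : Fin N) (t : ℕ) : B.Z e k t ≤ t := by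
  rw [Z_eq_sum]
  calc ∑ s ∈ Finset.Icc 1 t, 1 / B.M k (e s) ≤ ∑ s ∈ Finset.Icc 1 t, (1 : ℝ) :=
        Finset.sum_le_sum fun s _ => by
          rw [div_le_one (by linarith [hM k (e s)])]; exact hM k (e s)
    _ = t := by simp

/-- Information leakage: each round contributes at least `1 / maxM`, whichever expert was invoked.
-/
lemma le_Z (hM : ∀ i j, 1 ≤ B.M i j) (e : ℕ → Fin N) (k : Fin N) (t : ℕ) :
    t / B.maxM ≤ B.Z e k t := by
  rw [Z_eq_sum]
  calc (t : ℝ) / B.maxM = ∑ s ∈ Finset.Icc 1 t, 1 / B.maxM := by simp [div_eq_mul_inv]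
    _ ≤ _ := Finset.sum_le_sum fun s _ =>
        one_div_le_one_div_of_le (by linarith [hM k (e s)]) (B.M_le_maxM k (e s))

lemma Z_pos (hM : ∀ i j, 1 ≤ B.M i j) (e : ℕ → Fin N) (k : Fin N) {t : ℕ} (ht : 1 ≤ t) :
    0 < B.Z e k t := by
  have h1 : 0 < B.maxM := by linarith [hM k k, B.M_le_maxM k k]
  have h2 : (0 : ℝ) < t := by exact_mod_cast ht
  exact lt_of_lt_of_le (by positivity) (B.le_Z hM e k t)

lemma clippedEst_nonneg (hM : ∀ i j, 1 ≤ B.M i j) (x : ℕ → 𝒳) (e : ℕ → Fin N) (v : ℕ → Fin K)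
    {y : ℕ → ℝ} (hy : ∀ s, 0 ≤ y s) (ε : ℝ) (k : Fin N) {t : ℕ} (ht : 1 ≤ t) :
    0 ≤ B.clippedEst x e v y ε k t := by
  have hZ := B.Z_pos hM e k ht
  refine mul_nonneg (by positivity) (Finset.sum_nonneg fun j _ => Finset.sum_nonneg fun s _ => ?_)
  have h1 := hM k j
  have h2 := hy s
  have h3 := B.prob_nonneg k (v s) (x s)
  have h4 := B.prob_nonneg j (v s) (x s)
  refine mul_nonneg (by positivity) ?_
  split_ifs <;> norm_num

/-- The estimator clipped with parameter `ε ≠ 0` is a normalized sum of clipped rewards. -/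
lemma Z_mul_clippedEst (hM : ∀ i j, 1 ≤ B.M i j) (x : ℕ → 𝒳) (r : ℕ → Fin K → unitInterval)
    (e : ℕ → Fin N) (v : ℕ → Fin K) {ε : ℝ} (hε : ε ≠ 0) (k : Fin N) {t : ℕ} (ht : 1 ≤ t) :
    B.Z e k t * B.clippedEst x e v (fun s => (r s (v s) : ℝ)) ε k t =
      ∑ s ∈ Finset.Icc 1 t,
        B.clippedReward k (2 * Real.log (2 / ε)) (e s) ((x s, r s), v s) := by
  have hZ := B.Z_pos hM e k ht
  rw [clippedEst, ← mul_assoc, mul_one_div, div_self hZ.ne', one_mul,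
    ← Finset.sum_fiberwise (Finset.Icc 1 t) e]
  refine Finset.sum_congr rfl fun j _ => Finset.sum_congr rfl fun s hs => ?_
  rw [(Finset.mem_filter.1 hs).2]
  simp only [clippedReward, weight, hε, false_or]
  congr

/-- The sum over the rounds `1, …, t` of the deviations of the clipped rewards from their
conditional expectations given the past. -/
noncomputable def deviation (k : Fin N) (L : ℝ) (x : ℕ → 𝒳) (r : ℕ → Fin K → unitInterval)
    (e : ℕ → Fin N) (v : ℕ → Fin K) (t : ℕ) : ℝ :=
  ∑ s ∈ Finset.Icc 1 t, (B.clippedReward k L (e s) ((x s, r s), v s) -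
    ∫ z, B.clippedReward k L (e s) z ∂(B.roundLaw (e s)))

lemma beta_spec (hM : ∀ i j, 1 ≤ B.M i j) (e : ℕ → Fin N) (k : Fin N) {t : ℕ} (ht : 2 ≤ t) :
    0 < Real.sqrt (16 * t * Real.log t) / B.Z e k t ∧ 0 < B.beta e k t ∧ B.beta e k t < 2 ∧
      B.Z e k t * B.beta e k t =
        2 * (2 * Real.log (2 / B.beta e k t)) * Real.sqrt (t * Real.log t) := by
  have hZ := B.Z_pos hM e k (t := t) (by omega)
  have ht' : (2 : ℝ) ≤ t := by exact_mod_cast ht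
  have hlog : 0 < Real.log t := Real.log_pos (by linarith)
  have hc : 0 < Real.sqrt (16 * t * Real.log t) / B.Z e k t := by positivity
  obtain ⟨h1, h2, h3⟩ := betaSol_spec hc
  refine ⟨hc, h1, h2, ?_⟩
  change B.Z e k t * betaSol _ = 2 * (2 * Real.log (2 / betaSol _)) * _
  have hlb : 0 < Real.log (2 / betaSol (Real.sqrt (16 * t * Real.log t) / B.Z e k t)) :=
    Real.log_pos (by rw [lt_div_iff₀ h1]; linarith)
  rw [div_eq_div_iff hlb.ne' hZ.ne'] at h3
  rw [mul_comm, h3, show (16 : ℝ) * t * Real.log t = 4 ^ 2 * (t * Real.log t) by ring,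
    Real.sqrt_mul (by norm_num), Real.sqrt_sq (by norm_num)]
  ring

lemma one_lt_log_three : 1 < Real.log 3 := by
  rw [Real.lt_log_iff_exp_lt (by norm_num)]
  linarith [Real.exp_one_lt_d9]

/-- Keeps the adaptive level within reach of the grid. Since `Z ≤ t` and `log (2 / β) ≥ 1`, the
width equation gives `t β ≥ 4 √(t log t)`, so `t β² ≥ 4`; then `2 log (2 / β) = log (4 / β²) ≤ log t
< t`. -/
lemma clip_level_bounds (hM : ∀ i j, 1 ≤ B.M i j) (e : ℕ → Fin N) (k : Fin N) {t : ℕ}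
    (ht : 2 ≤ t) (hβ : B.beta e k t ≤ 2 / 3) :
    2 ≤ 2 * Real.log (2 / B.beta e k t) ∧ 2 * Real.log (2 / B.beta e k t) < t := by
  obtain ⟨-, h1, h2, h3⟩ := B.beta_spec hM e k ht
  have ht' : (2 : ℝ) ≤ t := by exact_mod_cast ht
  set β := B.beta e k t
  have hl : 1 ≤ Real.log (2 / β) := by
    refine one_lt_log_three.le.trans (Real.log_le_log (by norm_num) ?_)
    rw [le_div_iff₀ h1]; linarith
  refine ⟨by linarith, ?_⟩
  have hlog : 1 / 4 ≤ Real.log t := by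
    have := Real.log_le_log (by norm_num) ht'
    linarith [Real.log_two_gt_d9]
  have hs : 0 ≤ Real.sqrt (t * Real.log t) := Real.sqrt_nonneg _
  have hZ := B.Z_le hM e k t
  have h4 : 4 * Real.sqrt (t * Real.log t) ≤ t * β := by nlinarith
  have h5 : 16 * (t * Real.log t) ≤ (t * β) ^ 2 := by
    have := pow_le_pow_left₀ (by positivity) h4 2
    rw [mul_pow, Real.sq_sqrt (by positivity)] at this
    linarith
  have h6 : 4 ≤ t * β ^ 2 := by nlinarith
  calc 2 * Real.log (2 / β) = Real.log ((2 / β) ^ 2) := by rw [Real.log_pow]; norm_num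
    _ ≤ Real.log t := by
        refine Real.log_le_log (by positivity) ?_
        rw [div_pow, div_le_iff₀ (by positivity)]
        linarith
    _ < t := by linarith [Real.log_le_sub_one_of_pos (show (0 : ℝ) < t by linarith)]

/-- Rounding down to the grid costs at most `1 / 12` in the level. That mesh is fine enough for `exp
(13 / 12) ≤ 3`, so the bias is at most `3 β² / 4`, which is at most `β / 2` as `β ≤ 2 / 3`. -/
lemma exp_bias_le {β : ℝ} (h0 : 0 < β) (h1 : β ≤ 2 / 3) {L : ℝ}
    (hL : 2 * Real.log (2 / β) ≤ L + 1 / 12) : Real.exp (1 - L) ≤ β / 2 := by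
  have h2 : Real.exp (1 / 12) ≤ 12 / 11 := by
    have := Real.one_sub_le_exp_neg (1 / 12)
    rw [Real.exp_neg] at this
    rw [← inv_inv (Real.exp (1 / 12)), show (12 / 11 : ℝ) = (11 / 12)⁻¹ by norm_num]
    exact inv_anti₀ (by norm_num) (by linarith)
  have h3 : Real.exp (13 / 12) ≤ 3 := by
    rw [show (13 / 12 : ℝ) = 1 + 1 / 12 by norm_num, Real.exp_add]
    nlinarith [Real.exp_one_lt_d9, Real.exp_pos 1, Real.exp_pos (1 / 12)]
  have h4 : Real.exp (-(2 * Real.log (2 / β))) = β ^ 2 / 4 := by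
    rw [Real.exp_neg, show 2 * Real.log (2 / β) = Real.log ((2 / β) ^ 2) by
      rw [Real.log_pow]; norm_num, Real.exp_log (by positivity)]
    field_simp
    norm_num
  calc Real.exp (1 - L) ≤ Real.exp (13 / 12 + -(2 * Real.log (2 / β))) := by
        gcongr; linarith
    _ = Real.exp (13 / 12) * (β ^ 2 / 4) := by rw [Real.exp_add, h4]
    _ ≤ 3 * (β ^ 2 / 4) := by gcongr
    _ ≤ β / 2 := by nlinarith

/-- The index is an upper confidence bound if no deviation on the grid of clipping levels is very
negative. -/
lemma meanReward_le_ucb (hfin : ∀ i j : Fin N, B.logDiv i j ≠ ⊤) (x : ℕ → 𝒳)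
    (r : ℕ → Fin K → unitInterval) (e : ℕ → Fin N) (v : ℕ → Fin K) (k : Fin N) {t : ℕ}
    (ht : 2 ≤ t)
    (hgood : ∀ i ∈ Finset.Icc 1 (12 * t),
      -(2 * (i / 12 : ℝ) * Real.sqrt (t * Real.log t)) < B.deviation k (i / 12) x r e v t) :
    B.meanReward k ≤ B.ucb x e v (fun s => (r s (v s) : ℝ)) k t := by
  have hM : ∀ i j, 1 ≤ B.M i j := fun i j => (B.logDiv_facts (hfin i j)).2.2.2
  have hZ := B.Z_pos hM e k (t := t) (by omega)
  obtain ⟨-, h1, h2, h3⟩ := B.beta_spec hM e k ht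
  have hest := B.clippedEst_nonneg hM x e v (y := fun s => (r s (v s) : ℝ))
    (fun s => (r s (v s)).2.1) (B.beta e k t) k (t := t) (by omega)
  rw [ucb]
  -- For `β ≥ 2 / 3` the bonus `3/2 β` alone exceeds every mean, and the estimator is nonnegative.
  rcases le_or_gt (2 / 3) (B.beta e k t) with hβ | hβ
  · linarith [B.meanReward_le_one k]
  have hsum := B.Z_mul_clippedEst hM x r e v h1.ne' k (t := t) (by omega)
  obtain ⟨h4, h5⟩ := B.clip_level_bounds hM e k ht hβ.le
  set β := B.beta e k t
  set L := 2 * Real.log (2 / β)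
  -- The grid level just below `L` underestimates. Fluctuation costs `β` and bias `β / 2`, which is
  -- why the bonus is `3/2 β`.
  set i := ⌊12 * L⌋₊
  have hi1 : 24 ≤ i := Nat.le_floor (by push_cast; linarith)
  have hi2 : i < 12 * t := (Nat.floor_lt (by linarith)).2 (by push_cast; linarith)
  have hi3 : (i : ℝ) ≤ 12 * L := Nat.floor_le (by linarith)
  have hi4 : 12 * L < i + 1 := Nat.lt_floor_add_one _
  have hi1' : (24 : ℝ) ≤ i := by exact_mod_cast hi1
  have hdev := hgood i (Finset.mem_Icc.2 ⟨by omega, hi2.le⟩)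
  have hbias := exp_bias_le h1 hβ.le (L := (i / 12 : ℝ)) (by change L ≤ _; linarith)
  have hs : 0 ≤ Real.sqrt (t * Real.log t) := Real.sqrt_nonneg _
  have hdev' : -(B.Z e k t * β) < B.deviation k (i / 12) x r e v t := by
    refine lt_of_le_of_lt ?_ hdev
    rw [h3, neg_le_neg_iff]
    gcongr
    linarith
  have hmean : B.Z e k t * (B.meanReward k - β / 2) ≤ ∑ s ∈ Finset.Icc 1 t,
      ∫ z, B.clippedReward k (i / 12) (e s) z ∂(B.roundLaw (e s)) := by
    rw [Z_eq_sum, Finset.sum_mul]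
    refine Finset.sum_le_sum fun s _ => ?_
    refine le_trans ?_ (B.le_integral_clippedReward (hfin k (e s)) (by linarith))
    have := hM k (e s)
    rw [one_div_mul_eq_div]
    gcongr
  have hmono : ∑ s ∈ Finset.Icc 1 t, B.clippedReward k (i / 12) (e s) ((x s, r s), v s) ≤
      ∑ s ∈ Finset.Icc 1 t, B.clippedReward k L (e s) ((x s, r s), v s) :=
    Finset.sum_le_sum fun s _ => B.clippedReward_mono (hM k (e s)) (by linarith) _
  rw [deviation, Finset.sum_sub_distrib] at hdev'
  have : B.Z e k t * B.meanReward k ≤ B.Z e k t *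
      (B.clippedEst x e v (fun s => (r s (v s) : ℝ)) β k t + 3 / 2 * β) := by
    rw [mul_add, hsum]
    linarith
  exact le_of_mul_le_mul_left this hZ

/-- If no deviation on the grid of clipping levels is very large, then the index overestimates the
mean by at most `7/2` widths. -/
lemma ucb_le (hfin : ∀ i j : Fin N, B.logDiv i j ≠ ⊤) (x : ℕ → 𝒳)
    (r : ℕ → Fin K → unitInterval) (e : ℕ → Fin N) (v : ℕ → Fin K) (k : Fin N) {t : ℕ}
    (ht : 2 ≤ t) (hβ : B.beta e k t ≤ 2 / 3)
    (hgood : ∀ i ∈ Finset.Icc 1 (12 * t),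
      B.deviation k (i / 12) x r e v t < 2 * (i / 12 : ℝ) * Real.sqrt (t * Real.log t)) :
    B.ucb x e v (fun s => (r s (v s) : ℝ)) k t ≤ B.meanReward k + 7 / 2 * B.beta e k t := by
  have hM : ∀ i j, 1 ≤ B.M i j := fun i j => (B.logDiv_facts (hfin i j)).2.2.2
  have hZ := B.Z_pos hM e k (t := t) (by omega)
  obtain ⟨-, h1, h2, h3⟩ := B.beta_spec hM e k ht
  have hsum := B.Z_mul_clippedEst hM x r e v h1.ne' k (t := t) (by omega)
  obtain ⟨h4, h5⟩ := B.clip_level_bounds hM e k ht hβ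
  rw [ucb]
  set β := B.beta e k t
  set L := 2 * Real.log (2 / β)
  -- The grid level just above `L` overestimates. It is at most `L + 1 / 12 ≤ 2 L`, so fluctuation
  -- costs at most `2 β`; adding the bonus gives `7/2 β`.
  set i := ⌊12 * L⌋₊ + 1
  have hi2 : i ≤ 12 * t := (Nat.floor_lt (by linarith)).2 (by push_cast; linarith)
  have hi3 : (i : ℝ) ≤ 12 * L + 1 := by
    simp only [i]; push_cast; linarith [Nat.floor_le (show 0 ≤ 12 * L by linarith)]
  have hi4 : 12 * L < i := by simp only [i]; push_cast; exact Nat.lt_floor_add_one _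
  have hdev := hgood i (Finset.mem_Icc.2 ⟨by omega, hi2⟩)
  have hs : 0 ≤ Real.sqrt (t * Real.log t) := Real.sqrt_nonneg _
  have hdev' : B.deviation k (i / 12) x r e v t < 2 * (B.Z e k t * β) := by
    refine lt_of_lt_of_le hdev ?_
    rw [h3, show 2 * (2 * L * Real.sqrt (t * Real.log t)) =
      2 * (2 * L) * Real.sqrt (t * Real.log t) by ring]
    gcongr
    linarith
  have hmean : ∑ s ∈ Finset.Icc 1 t,
      ∫ z, B.clippedReward k (i / 12) (e s) z ∂(B.roundLaw (e s)) ≤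
      B.Z e k t * B.meanReward k := by
    rw [Z_eq_sum, Finset.sum_mul]
    refine Finset.sum_le_sum fun s _ => ?_
    rw [one_div_mul_eq_div]
    exact B.integral_clippedReward_le (hM k (e s)) (by positivity)
  have hmono : ∑ s ∈ Finset.Icc 1 t, B.clippedReward k L (e s) ((x s, r s), v s) ≤
      ∑ s ∈ Finset.Icc 1 t, B.clippedReward k (i / 12) (e s) ((x s, r s), v s) :=
    Finset.sum_le_sum fun s _ => B.clippedReward_mono (hM k (e s)) (by linarith) _
  rw [deviation, Finset.sum_sub_distrib] at hdev'
  have : B.Z e k t * (B.clippedEst x e v (fun s => (r s (v s) : ℝ)) β k t + 3 / 2 * β) ≤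
      B.Z e k t * (B.meanReward k + 7 / 2 * β) := by
    rw [mul_add, hsum]
    linarith
  exact le_of_mul_le_mul_left this hZ

/-- A suboptimal expert whose width exceeds a quarter of its gap has been compared in few rounds. -/
lemma le_of_gap_le_beta (hM : ∀ i j, 1 ≤ B.M i j) (e : ℕ → Fin N) (k : Fin N) {t T : ℕ}
    (ht : 2 ≤ t) (htT : t ≤ T) {d : ℝ} (hd : 0 < d) (hd1 : d ≤ 1) (h : d / 4 ≤ B.beta e k t) :
    (t : ℝ) ≤ 1024 * B.maxM ^ 2 * Real.log T / gammaFn d := by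
  have hc := (B.beta_spec hM e k ht).1
  have hZ := B.Z_pos hM e k (t := t) (by omega)
  have hγ := gammaFn_le_of_le_betaSol hc hd hd1 h
  have ht' : (2 : ℝ) ≤ t := by exact_mod_cast ht
  have hlog : 0 < Real.log t := Real.log_pos (by linarith)
  have hlogT : Real.log t ≤ Real.log T := Real.log_le_log (by linarith) (by exact_mod_cast htT)
  have hM0 : 0 < B.maxM := by linarith [hM k k, B.M_le_maxM k k]
  have hZt := B.le_Z hM e k t
  rw [div_le_iff₀ hM0] at hZt
  rw [div_pow, Real.sq_sqrt (by positivity), ← mul_div_assoc, le_div_iff₀ (by positivity)] at hγ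
  rw [le_div_iff₀ (gammaFn_pos hd hd1)]
  have h1 : (t : ℝ) ^ 2 ≤ (B.Z e k t * B.maxM) ^ 2 := by gcongr
  have hγ0 := gammaFn_pos hd hd1
  -- One factor `t` cancels against the one under the square root in the width equation; `1024 = 64
  -- * 16`.
  have h2 : (t : ℝ) * (t * gammaFn d) ≤ t * (1024 * B.maxM ^ 2 * Real.log t) := by
    calc (t : ℝ) * (t * gammaFn d) = t ^ 2 * gammaFn d := by ring
      _ ≤ (B.Z e k t * B.maxM) ^ 2 * gammaFn d := by gcongr
      _ = B.maxM ^ 2 * (gammaFn d * B.Z e k t ^ 2) := by ring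
      _ ≤ B.maxM ^ 2 * (64 * (16 * t * Real.log t)) := by gcongr
      _ = _ := by ring
  calc (t : ℝ) * gammaFn d ≤ 1024 * B.maxM ^ 2 * Real.log t :=
        le_of_mul_le_mul_left h2 (by linarith)
    _ ≤ _ := by gcongr

end ExpertBandit

/-! ### Probability of the failure events -/

namespace ExpertBandit

variable {𝒳 : Type*} [MeasurableSpace 𝒳] {K N : ℕ} {B : ExpertBandit 𝒳 K N}
  {Ω : Type*} [mΩ : MeasurableSpace Ω] {P : Measure Ω} {ℱ : Filtration ℕ mΩ} {T : ℕ}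
  {X : ℕ → Ω → 𝒳} {R : ℕ → Ω → Fin K → unitInterval} {E : ℕ → Ω → Fin N} {V : ℕ → Ω → Fin K}

namespace IsDUCBRun

lemma measurable_deviation (h : B.IsDUCBRun P ℱ T X R E V) (k : Fin N) (L : ℝ) {t : ℕ}
    (ht : t ≤ T) :
    Measurable fun ω => B.deviation k L (fun s => X s ω) (fun s => R s ω) (fun s => E s ω)
      (fun s => V s ω) t := by
  refine Finset.measurable_fun_sum _ fun s hs => ?_
  rw [Finset.mem_Icc] at hs
  exact (h.measurable_comp_round (φ := fun j z => B.clippedReward k L j z -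
    ∫ y, B.clippedReward k L j y ∂(B.roundLaw j))
    (fun j => (B.measurable_clippedReward k L j).sub_const _) hs.1 (by omega)).mono (ℱ.le s) le_rfl

/-- The exponent is `8 log t`. The free `w` covers both interval lengths `L - 0` and `0 - -L`. -/
lemma exp_hoeffding_exponent {L : ℝ} (hL : 0 < L) {t : ℕ} (ht : 2 ≤ t) {w : ℝ} (hw : w ^ 2 = L ^ 2) :
    ENNReal.ofReal (Real.exp (-(2 * (2 * L * Real.sqrt (t * Real.log t)) ^ 2 / (t * w ^ 2)))) =
      ENNReal.ofReal (1 / (t : ℝ) ^ 8) := by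
  have ht' : (2 : ℝ) ≤ t := by exact_mod_cast ht
  have ht0 : (0 : ℝ) < t := by linarith
  have hlog : 0 < Real.log t := Real.log_pos (by linarith)
  congr 1
  rw [hw, mul_pow, Real.sq_sqrt (by positivity),
    show 2 * ((2 * L) ^ 2 * (t * Real.log t)) / (t * L ^ 2) = (8 : ℕ) * Real.log t by
      push_cast; field_simp; ring,
    Real.exp_neg, Real.exp_nat_mul, Real.exp_log ht0, one_div]

lemma measure_deviation_ge_le [IsProbabilityMeasure P] (h : B.IsDUCBRun P ℱ T X R E V)
    (hM : ∀ i j, 1 ≤ B.M i j) (k : Fin N) {L : ℝ} (hL : 0 < L) {t : ℕ} (ht : 2 ≤ t) (htT : t ≤ T) :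
    P {ω | 2 * L * Real.sqrt (t * Real.log t) ≤ B.deviation k L (fun s => X s ω)
      (fun s => R s ω) (fun s => E s ω) (fun s => V s ω) t} ≤ ENNReal.ofReal (1 / (t : ℝ) ^ 8) := by
  rw [← exp_hoeffding_exponent hL ht (w := L - 0) (by ring)]
  exact h.measure_sum_sub_ge_le (f := B.clippedReward k L) (B.measurable_clippedReward k L) hL
    (fun j z => ⟨B.clippedReward_nonneg (hM k j) L z, B.clippedReward_le (hM k j) hL.le z⟩)
    (by omega) htT _ (by positivity)

lemma measure_deviation_le_le [IsProbabilityMeasure P] (h : B.IsDUCBRun P ℱ T X R E V)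
    (hM : ∀ i j, 1 ≤ B.M i j) (k : Fin N) {L : ℝ} (hL : 0 < L) {t : ℕ} (ht : 2 ≤ t) (htT : t ≤ T) :
    P {ω | B.deviation k L (fun s => X s ω) (fun s => R s ω) (fun s => E s ω)
      (fun s => V s ω) t ≤ -(2 * L * Real.sqrt (t * Real.log t))} ≤
      ENNReal.ofReal (1 / (t : ℝ) ^ 8) := by
  rw [← exp_hoeffding_exponent hL ht (w := 0 - -L) (by ring)]
  refine le_trans (measure_mono fun ω hω => ?_)
    (h.measure_sum_sub_ge_le (f := fun j z => -B.clippedReward k L j z) (a := -L) (b := 0)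
      (fun j => (B.measurable_clippedReward k L j).neg) (by linarith)
      (fun j z => ⟨by linarith [B.clippedReward_le (hM k j) hL.le z],
        by linarith [B.clippedReward_nonneg (hM k j) L z]⟩)
      (t := t) (by omega) htT _ (by positivity))
  simp only [Set.mem_ofPred_eq, deviation] at hω ⊢
  have hneg : ∀ s ∈ Finset.Icc 1 t, -B.clippedReward k L (E s ω) ((X s ω, R s ω), V s ω) -
      ∫ z, -B.clippedReward k L (E s ω) z ∂(B.roundLaw (E s ω)) =
      -(B.clippedReward k L (E s ω) ((X s ω, R s ω), V s ω) -
        ∫ z, B.clippedReward k L (E s ω) z ∂(B.roundLaw (E s ω))) := by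
    intro s _
    rw [integral_neg]
    ring
  rw [Finset.sum_congr rfl hneg, Finset.sum_neg_distrib]
  linarith

end IsDUCBRun

/-- The event that some deviation on the grid of clipping levels is very large after round `t`. -/
def overEvent (B : ExpertBandit 𝒳 K N) (X : ℕ → Ω → 𝒳) (R : ℕ → Ω → Fin K → unitInterval)
    (E : ℕ → Ω → Fin N) (V : ℕ → Ω → Fin K) (k : Fin N) (t : ℕ) : Set Ω :=
  ⋃ i ∈ Finset.Icc 1 (12 * t), {ω | 2 * (i / 12 : ℝ) * Real.sqrt (t * Real.log t) ≤
    B.deviation k (i / 12) (fun s => X s ω) (fun s => R s ω) (fun s => E s ω) (fun s => V s ω) t}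

/-- The event that some deviation on the grid of clipping levels is very negative after
round `t`. -/
def underEvent (B : ExpertBandit 𝒳 K N) (X : ℕ → Ω → 𝒳) (R : ℕ → Ω → Fin K → unitInterval)
    (E : ℕ → Ω → Fin N) (V : ℕ → Ω → Fin K) (k : Fin N) (t : ℕ) : Set Ω :=
  ⋃ i ∈ Finset.Icc 1 (12 * t), {ω | B.deviation k (i / 12) (fun s => X s ω) (fun s => R s ω)
    (fun s => E s ω) (fun s => V s ω) t ≤ -(2 * (i / 12 : ℝ) * Real.sqrt (t * Real.log t))}

lemma measureReal_grid_union_le [IsProbabilityMeasure P] {t : ℕ} (ht : 2 ≤ t) (S : ℕ → Set Ω)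
    (hS : ∀ i ∈ Finset.Icc 1 (12 * t), P (S i) ≤ ENNReal.ofReal (1 / (t : ℝ) ^ 8)) :
    P.real (⋃ i ∈ Finset.Icc 1 (12 * t), S i) ≤ 1 / (t : ℝ) ^ 2 := by
  have ht' : (2 : ℝ) ≤ t := by exact_mod_cast ht
  have ht0 : (0 : ℝ) < t := by linarith
  calc P.real (⋃ i ∈ Finset.Icc 1 (12 * t), S i)
      ≤ ∑ i ∈ Finset.Icc 1 (12 * t), P.real (S i) := measureReal_biUnion_finset_le _ _
    _ ≤ ∑ i ∈ Finset.Icc 1 (12 * t), 1 / (t : ℝ) ^ 8 :=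
        Finset.sum_le_sum fun i hi => ENNReal.toReal_le_of_le_ofReal (by positivity) (hS i hi)
    _ = 12 * t * (1 / (t : ℝ) ^ 8) := by simp
    _ ≤ 1 / (t : ℝ) ^ 2 := by
        rw [mul_one_div, div_le_div_iff₀ (by positivity) (by positivity), one_mul]
        have h5 : (2 : ℝ) ^ 5 ≤ (t : ℝ) ^ 5 := by gcongr
        calc 12 * (t : ℝ) * (t : ℝ) ^ 2 = 12 * (t : ℝ) ^ 3 := by ring
          _ ≤ (t : ℝ) ^ 5 * (t : ℝ) ^ 3 := by gcongr; linarith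
          _ = (t : ℝ) ^ 8 := by ring

namespace IsDUCBRun

lemma measurableSet_overEvent (h : B.IsDUCBRun P ℱ T X R E V) (k : Fin N) {t : ℕ} (ht : t ≤ T) :
    MeasurableSet (B.overEvent X R E V k t) :=
  Finset.measurableSet_biUnion _ fun _ _ =>
    measurableSet_le measurable_const (h.measurable_deviation k _ ht)

lemma measurableSet_underEvent (h : B.IsDUCBRun P ℱ T X R E V) (k : Fin N) {t : ℕ} (ht : t ≤ T) :
    MeasurableSet (B.underEvent X R E V k t) :=
  Finset.measurableSet_biUnion _ fun _ _ =>
    measurableSet_le (h.measurable_deviation k _ ht) measurable_const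

lemma measureReal_overEvent_le [IsProbabilityMeasure P] (h : B.IsDUCBRun P ℱ T X R E V)
    (hM : ∀ i j, 1 ≤ B.M i j) (k : Fin N) {t : ℕ} (ht : 2 ≤ t) (htT : t ≤ T) :
    P.real (B.overEvent X R E V k t) ≤ 1 / (t : ℝ) ^ 2 :=
  measureReal_grid_union_le ht _ fun i hi => by
    have : (0 : ℝ) < i := by exact_mod_cast (Finset.mem_Icc.1 hi).1
    exact h.measure_deviation_ge_le hM k (by positivity) ht htT

lemma measureReal_underEvent_le [IsProbabilityMeasure P] (h : B.IsDUCBRun P ℱ T X R E V)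
    (hM : ∀ i j, 1 ≤ B.M i j) (k : Fin N) {t : ℕ} (ht : 2 ≤ t) (htT : t ≤ T) :
    P.real (B.underEvent X R E V k t) ≤ 1 / (t : ℝ) ^ 2 :=
  measureReal_grid_union_le ht _ fun i hi => by
    have : (0 : ℝ) < i := by exact_mod_cast (Finset.mem_Icc.1 hi).1
    exact h.measure_deviation_le_le hM k (by positivity) ht htT

end IsDUCBRun

end ExpertBandit

/-! ### Summing the active gaps over time -/

lemma sum_Icc_sub_telescope (d : ℕ → ℝ) {n : ℕ} (hn : 1 ≤ n) :
    ∑ k ∈ Finset.Icc 2 n, (d k - d (k - 1)) = d n - d 1 := by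
  induction n, hn using Nat.le_induction with
  | base => simp
  | succ n hn ih => rw [Finset.sum_Icc_succ_top (by omega), ih, Nat.add_sub_cancel]; ring

/-- Summation by parts. -/
lemma sum_Icc_sub_mul (d τ : ℕ → ℝ) (hd : d 1 = 0) {N : ℕ} (hN : 1 ≤ N) :
    ∑ k ∈ Finset.Icc 2 N, (d k - d (k - 1)) * τ k =
      d N * τ N + ∑ k ∈ Finset.Icc 2 (N - 1), d k * (τ k - τ (k + 1)) := by
  induction N, hN using Nat.le_induction with
  | base => simp [hd]
  | succ n hn ih =>
    rw [Finset.sum_Icc_succ_top (by omega), ih, Nat.add_sub_cancel]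
    rcases hn.eq_or_lt with rfl | hn
    · simp [hd]
    · obtain ⟨m, rfl⟩ : ∃ m, n = m + 1 := ⟨n - 1, by omega⟩
      rw [Finset.sum_Icc_succ_top (by omega), Nat.add_sub_cancel]
      ring

lemma sum_indicator_le_le {τ : ℝ} (hτ : 0 ≤ τ) (n : ℕ) :
    ∑ t ∈ Finset.Icc 2 n, (if (t : ℝ) ≤ τ then (1 : ℝ) else 0) ≤ τ := by
  rw [Finset.sum_boole]
  refine le_trans ?_ (Nat.floor_le hτ)
  norm_cast
  calc _ ≤ (Finset.Icc 1 ⌊τ⌋₊).card := by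
        refine Finset.card_le_card fun t ht => ?_
        rw [Finset.mem_filter, Finset.mem_Icc] at ht
        exact Finset.mem_Icc.2 ⟨by omega, Nat.le_floor ht.2⟩
    _ = ⌊τ⌋₊ := by simp

lemma sum_one_div_sq_le (n : ℕ) : ∑ t ∈ Finset.Icc 1 n, 1 / (t : ℝ) ^ 2 ≤ Real.pi ^ 2 / 6 :=
  sum_le_hasSum _ (fun _ _ => by positivity) hasSum_zeta_two

/-- The largest of the gaps `d 1 ≤ ⋯ ≤ d N` whose threshold `Q / γ(d k)` is at least `t`, written
as a telescoping sum. -/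
noncomputable def activeGap (d : ℕ → ℝ) (N : ℕ) (Q : ℝ) (t : ℕ) : ℝ :=
  ∑ k ∈ Finset.Icc 2 N, (d k - d (k - 1)) * (if (t : ℝ) ≤ Q / gammaFn (d k) then 1 else 0)

section ActiveGap

variable {d : ℕ → ℝ} {N : ℕ} {Q : ℝ}

lemma activeGap_term_nonneg (hmono : ∀ i j, 1 ≤ i → i ≤ j → j ≤ N → d i ≤ d j) (t : ℕ) {k : ℕ}
    (hk : k ∈ Finset.Icc 2 N) :
    0 ≤ (d k - d (k - 1)) * (if (t : ℝ) ≤ Q / gammaFn (d k) then (1 : ℝ) else 0) := by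
  rw [Finset.mem_Icc] at hk
  have := hmono (k - 1) k (by omega) (by omega) hk.2
  refine mul_nonneg (by linarith) ?_
  split_ifs <;> norm_num

lemma activeGap_nonneg (hmono : ∀ i j, 1 ≤ i → i ≤ j → j ≤ N → d i ≤ d j) (t : ℕ) :
    0 ≤ activeGap d N Q t :=
  Finset.sum_nonneg fun _ hk => activeGap_term_nonneg hmono t hk

/-- As `γ` is increasing, thresholds decrease with the gap: if `d n` is active, so is every smaller
positive gap, and the increments up to `n` telescope to `d n`. Zero gaps have zero increments, so
their thresholds are irrelevant. -/
lemma le_activeGap (hQ : 0 ≤ Q) (hd1 : d 1 = 0)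
    (hmono : ∀ i j, 1 ≤ i → i ≤ j → j ≤ N → d i ≤ d j) {n : ℕ} (hn1 : 1 ≤ n) (hnN : n ≤ N)
    (hdn : d n ≤ 1) {t : ℕ} (ht : 0 < d n → (t : ℝ) ≤ Q / gammaFn (d n)) :
    d n ≤ activeGap d N Q t := by
  calc d n = ∑ k ∈ Finset.Icc 2 n, (d k - d (k - 1)) := by
        rw [sum_Icc_sub_telescope d hn1, hd1, sub_zero]
    _ ≤ ∑ k ∈ Finset.Icc 2 n,
          (d k - d (k - 1)) * (if (t : ℝ) ≤ Q / gammaFn (d k) then 1 else 0) := by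
        refine Finset.sum_le_sum fun k hk => ?_
        rw [Finset.mem_Icc] at hk
        have h1 : 0 ≤ d (k - 1) := hd1 ▸ hmono 1 (k - 1) le_rfl (by omega) (by omega)
        have h2 : d (k - 1) ≤ d k := hmono (k - 1) k (by omega) (by omega) (by omega)
        have h3 : d k ≤ d n := hmono k n (by omega) hk.2 hnN
        rcases (h1.trans h2).eq_or_lt with h0 | h0
        · have : d k - d (k - 1) = 0 := by linarith
          simp [this]
        · have hle : (t : ℝ) ≤ Q / gammaFn (d k) := by
            refine (ht (h0.trans_le h3)).trans ?_
            have := gammaFn_pos h0 (h3.trans hdn)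
            have := gammaFn_mono h0 h3 hdn
            gcongr
          rw [if_pos hle, mul_one]
    _ ≤ activeGap d N Q t :=
        Finset.sum_le_sum_of_subset_of_nonneg (Finset.Icc_subset_Icc_right hnN)
          fun k hk _ => activeGap_term_nonneg hmono t hk

lemma sum_activeGap_le (hQ : 0 ≤ Q) (hmono : ∀ i j, 1 ≤ i → i ≤ j → j ≤ N → d i ≤ d j)
    (n : ℕ) :
    ∑ t ∈ Finset.Icc 2 n, activeGap d N Q t ≤
      ∑ k ∈ Finset.Icc 2 N, (d k - d (k - 1)) * (Q / gammaFn (d k)) := by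
  unfold activeGap
  rw [Finset.sum_comm]
  refine Finset.sum_le_sum fun k hk => ?_
  rw [Finset.mem_Icc] at hk
  have := hmono (k - 1) k (by omega) (by omega) hk.2
  rw [← Finset.mul_sum]
  refine mul_le_mul_of_nonneg_left (sum_indicator_le_le ?_ n) (by linarith)
  unfold gammaFn
  positivity

/-- At `x = 0` both sides vanish by the division convention, which matches the reading of zero-gap
terms. -/
lemma mul_div_gammaFn (Q x : ℝ) : x * (Q / gammaFn x) = Q * Real.log (6 / x) ^ 2 / x := by
  rcases eq_or_ne x 0 with rfl | hx
  · simp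
  · rw [gammaFn, div_div_eq_mul_div]
    field_simp

lemma sum_mul_div_gammaFn (hd1 : d 1 = 0) (hN : 1 ≤ N)
    (hmono : ∀ i j, 1 ≤ i → i ≤ j → j ≤ N → d i ≤ d j) (hle : ∀ i, d i ≤ 1) :
    ∑ k ∈ Finset.Icc 2 N, (d k - d (k - 1)) * (Q / gammaFn (d k)) =
      Q * Real.log (6 / d N) ^ 2 / d N + ∑ k ∈ Finset.Icc 2 (N - 1),
        Q * Real.log (6 / d k) ^ 2 / d k * (1 - gammaFn (d k) / gammaFn (d (k + 1))) := by
  rw [sum_Icc_sub_mul d (fun k => Q / gammaFn (d k)) hd1 hN, mul_div_gammaFn]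
  congr 1
  refine Finset.sum_congr rfl fun k hk => ?_
  rw [Finset.mem_Icc] at hk
  rw [← mul_div_gammaFn]
  have h0 : 0 ≤ d k := hd1 ▸ hmono 1 k le_rfl (by omega) (by omega)
  rcases h0.eq_or_lt with h0 | h0
  · simp [← h0]
  · have hγ := (gammaFn_pos h0 (hle k)).ne'
    field_simp

end ActiveGap

/-! ### Ordered gaps and the expected regret -/

namespace ExpertBandit

variable {𝒳 : Type*} [MeasurableSpace 𝒳] {K N : ℕ} (B : ExpertBandit 𝒳 K N)

lemma meanReward_le_bestMean (k : Fin N) : B.meanReward k ≤ B.bestMean :=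
  le_ciSup (Set.finite_range _).bddAbove k

lemma gap_nonneg (k : Fin N) : 0 ≤ B.gap k := sub_nonneg.2 (B.meanReward_le_bestMean k)

lemma exists_meanReward_eq_bestMean (hN : 1 ≤ N) : ∃ k, B.meanReward k = B.bestMean := by
  have : Nonempty (Fin N) := ⟨⟨0, hN⟩⟩
  exact exists_eq_ciSup_of_finite

lemma gap_le_one (k : Fin N) : B.gap k ≤ 1 := by
  obtain ⟨l, hl⟩ := B.exists_meanReward_eq_bestMean (Nat.one_le_of_lt k.2)
  rw [gap, ← hl]
  linarith [B.meanReward_le_one l, B.meanReward_nonneg k]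

lemma orderedGap_succ (i : Fin N) : B.orderedGap (i + 1) = B.gap (Tuple.sort B.gap i) := by
  rw [orderedGap, dif_pos ⟨by omega, by omega⟩]
  rfl

lemma gap_eq_orderedGap (k : Fin N) :
    B.gap k = B.orderedGap ((Tuple.sort B.gap).symm k + 1) := by
  rw [orderedGap_succ, Equiv.apply_symm_apply]

lemma orderedGap_le_one (k : ℕ) : B.orderedGap k ≤ 1 := by
  unfold orderedGap
  split_ifs
  · exact B.gap_le_one _
  · norm_num

lemma orderedGap_mono {i j : ℕ} (hi : 1 ≤ i) (hij : i ≤ j) (hj : j ≤ N) :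
    B.orderedGap i ≤ B.orderedGap j := by
  rw [orderedGap, dif_pos ⟨hi, hij.trans hj⟩, orderedGap, dif_pos ⟨hi.trans hij, hj⟩]
  exact Tuple.monotone_sort B.gap (Fin.mk_le_mk.2 (by omega))

lemma orderedGap_one (hN : 1 ≤ N) : B.orderedGap 1 = 0 := by
  obtain ⟨k, hk⟩ := B.exists_meanReward_eq_bestMean hN
  have h1 : B.gap k = 0 := sub_eq_zero.2 hk.symm
  have h2 : B.orderedGap 1 ≤ B.gap k := by
    rw [gap_eq_orderedGap]
    exact B.orderedGap_mono le_rfl (by omega) (by omega)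
  have h3 : 0 ≤ B.orderedGap 1 := by
    rw [orderedGap, dif_pos ⟨le_rfl, hN⟩]
    exact B.gap_nonneg _
  linarith

lemma sum_gap_eq (hN : 1 ≤ N) : ∑ k, B.gap k = ∑ i ∈ Finset.Icc 2 N, B.orderedGap i := by
  calc ∑ k, B.gap k = ∑ i : Fin N, B.orderedGap (i + 1) := by
        rw [← Equiv.sum_comp (Tuple.sort B.gap) B.gap]
        exact Finset.sum_congr rfl fun i _ => (B.orderedGap_succ i).symm
    _ = ∑ i ∈ Finset.range N, B.orderedGap (i + 1) :=
        Fin.sum_univ_eq_sum_range (fun i => B.orderedGap (i + 1)) N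
    _ = ∑ i ∈ Finset.Icc 1 N, B.orderedGap i := by
        rw [Finset.range_eq_Ico, Finset.sum_Ico_add' B.orderedGap 0 N 1]
        rfl
    _ = ∑ i ∈ Finset.Icc 2 N, B.orderedGap i := by
        rw [← Finset.add_sum_Ioc_eq_sum_Icc hN, B.orderedGap_one hN, zero_add]
        rfl

lemma gap_le_sum (k : Fin N) : B.gap k ≤ ∑ l, B.gap l :=
  Finset.single_le_sum (fun l _ => B.gap_nonneg l) (Finset.mem_univ k)

/-- Off the events of large deviations, a suboptimal expert is invoked only in early rounds. -/
lemma le_of_argmax (hfin : ∀ i j : Fin N, B.logDiv i j ≠ ⊤) (x : ℕ → 𝒳)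
    (r : ℕ → Fin K → unitInterval) (e : ℕ → Fin N) (v : ℕ → Fin K) {t T : ℕ} (ht : 2 ≤ t)
    (htT : t ≤ T) {b k : Fin N} (hb : B.meanReward b = B.bestMean)
    (hbest : ∀ i ∈ Finset.Icc 1 (12 * t),
      -(2 * (i / 12 : ℝ) * Real.sqrt (t * Real.log t)) < B.deviation b (i / 12) x r e v t)
    (hk : ∀ i ∈ Finset.Icc 1 (12 * t),
      B.deviation k (i / 12) x r e v t < 2 * (i / 12 : ℝ) * Real.sqrt (t * Real.log t))
    (harg : B.ucb x e v (fun s => (r s (v s) : ℝ)) b t ≤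
      B.ucb x e v (fun s => (r s (v s) : ℝ)) k t) (hgap : 0 < B.gap k) :
    (t : ℝ) ≤ 1024 * B.maxM ^ 2 * Real.log T / gammaFn (B.gap k) := by
  have hM : ∀ i j, 1 ≤ B.M i j := fun i j => (B.logDiv_facts (hfin i j)).2.2.2
  refine B.le_of_gap_le_beta hM e k ht htT hgap (B.gap_le_one k) ?_
  rcases le_or_gt (B.beta e k t) (2 / 3) with hβ | hβ
  · have h1 := B.meanReward_le_ucb hfin x r e v b ht hbest
    have h2 := B.ucb_le hfin x r e v k ht hβ hk
    have h3 := (B.beta_spec hM e k ht).2.1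
    rw [gap]
    linarith
  -- Here `β > 2 / 3`, while a quarter of a gap is at most `1 / 4`.
  · linarith [B.gap_le_one k]

namespace IsDUCBRun

variable {B} {Ω : Type*} [mΩ : MeasurableSpace Ω] {P : Measure Ω} {ℱ : Filtration ℕ mΩ} {T : ℕ}
  {X : ℕ → Ω → 𝒳} {R : ℕ → Ω → Fin K → unitInterval} {E : ℕ → Ω → Fin N} {V : ℕ → Ω → Fin K}

lemma integrable_gap [IsProbabilityMeasure P] (h : B.IsDUCBRun P ℱ T X R E V) {t : ℕ}
    (h1 : 1 ≤ t) (h2 : t ≤ T) : Integrable (fun ω => B.gap (E t ω)) P :=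
  Integrable.of_mem_Icc 0 1 ((Measurable.of_discrete (f := B.gap)).comp
    (h.measurable_expert h1 h2)).aemeasurable
    (.of_forall fun _ => ⟨B.gap_nonneg _, B.gap_le_one _⟩)

lemma integral_gap_le_sum [IsProbabilityMeasure P] (h : B.IsDUCBRun P ℱ T X R E V) {t : ℕ}
    (h1 : 1 ≤ t) (h2 : t ≤ T) : ∫ ω, B.gap (E t ω) ∂P ≤ ∑ k, B.gap k := by
  have := integral_mono (h.integrable_gap h1 h2) (integrable_const (∑ k, B.gap k))
    fun ω => B.gap_le_sum (E t ω)
  simpa using this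

/-- The expected regret of round `t + 1`. -/
lemma integral_gap_succ_le [IsProbabilityMeasure P] (h : B.IsDUCBRun P ℱ T X R E V)
    (hN : 1 ≤ N) (hfin : ∀ i j : Fin N, B.logDiv i j ≠ ⊤) {t : ℕ} (ht : 2 ≤ t)
    (htT : t + 1 ≤ T) :
    ∫ ω, B.gap (E (t + 1) ω) ∂P ≤
      activeGap B.orderedGap N (1024 * B.maxM ^ 2 * Real.log T) t +
        2 * (∑ k, B.gap k) * (1 / (t : ℝ) ^ 2) := by
  have hM : ∀ i j, 1 ≤ B.M i j := fun i j => (B.logDiv_facts (hfin i j)).2.2.2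
  obtain ⟨b, hb⟩ := B.exists_meanReward_eq_bestMean hN
  set S := ∑ k, B.gap k
  set Q := 1024 * B.maxM ^ 2 * Real.log T
  set D := activeGap B.orderedGap N Q t
  have hQ : 0 ≤ Q := by
    have : 0 ≤ Real.log T := Real.log_natCast_nonneg T
    positivity
  have hmono : ∀ i j, 1 ≤ i → i ≤ j → j ≤ N → B.orderedGap i ≤ B.orderedGap j :=
    fun i j => B.orderedGap_mono
  have hD : 0 ≤ D := activeGap_nonneg hmono t
  have hS : 0 ≤ S := Finset.sum_nonneg fun k _ => B.gap_nonneg k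
  set U := B.underEvent X R E V b t
  set O := fun k => B.overEvent X R E V k t
  have hU : MeasurableSet U := h.measurableSet_underEvent b (by omega)
  have hO : ∀ k, MeasurableSet (O k) := fun k => h.measurableSet_overEvent k (by omega)
  have hUind : ∀ ω, 0 ≤ U.indicator (fun _ => S) ω := fun ω => Set.indicator_nonneg (fun _ _ => hS) ω
  have hOind : ∀ k ω, 0 ≤ (O k).indicator (fun _ => B.gap k) ω := fun k ω =>
    Set.indicator_nonneg (fun _ _ => B.gap_nonneg k) ω
  -- A failure of the best expert `b` is charged `S`; one of the invoked expert `k` only its own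
  -- gap. As `k` is random, the latter is dominated by the sum over all experts, so each kind costs
  -- `S / t²` in expectation.
  have hpoint : ∀ᵐ ω ∂P, B.gap (E (t + 1) ω) ≤
      D + (U.indicator (fun _ => S) ω + ∑ k, (O k).indicator (fun _ => B.gap k) ω) := by
    filter_upwards [h.argmax (t + 1) (by omega) htT] with ω harg
    rw [Nat.add_sub_cancel] at harg
    set k := E (t + 1) ω
    have hsum : (O k).indicator (fun _ => B.gap k) ω ≤
        ∑ k, (O k).indicator (fun _ => B.gap k) ω :=
      Finset.single_le_sum (f := fun k => (O k).indicator (fun _ => B.gap k) ω)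
        (fun l _ => hOind l ω) (Finset.mem_univ k)
    by_cases hωU : ω ∈ U
    · rw [Set.indicator_of_mem hωU]
      linarith [B.gap_le_sum k, hOind k ω]
    by_cases hωO : ω ∈ O k
    · rw [Set.indicator_of_mem hωO] at hsum
      linarith [hUind ω]
    have hgood : B.gap k ≤ D := by
      have hbest : ∀ i ∈ Finset.Icc 1 (12 * t),
          -(2 * (i / 12 : ℝ) * Real.sqrt (t * Real.log t)) < B.deviation b (i / 12)
            (fun s => X s ω) (fun s => R s ω) (fun s => E s ω) (fun s => V s ω) t := by
        intro i hi
        by_contra hcon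
        exact hωU (Set.mem_biUnion (Finset.mem_coe.2 hi) (not_lt.1 hcon))
      have hover : ∀ i ∈ Finset.Icc 1 (12 * t), B.deviation k (i / 12)
            (fun s => X s ω) (fun s => R s ω) (fun s => E s ω) (fun s => V s ω) t <
          2 * (i / 12 : ℝ) * Real.sqrt (t * Real.log t) := by
        intro i hi
        by_contra hcon
        exact hωO (Set.mem_biUnion (Finset.mem_coe.2 hi) (not_lt.1 hcon))
      have key := B.le_of_argmax hfin (fun s => X s ω) (fun s => R s ω) (fun s => E s ω)
        (fun s => V s ω) ht (show t ≤ T by omega) hb hbest hover (harg b)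
      rw [B.gap_eq_orderedGap k] at key ⊢
      exact le_activeGap hQ (B.orderedGap_one hN) hmono (by omega) (by omega)
        (B.orderedGap_le_one _) key
    linarith [hUind ω, hOind k ω]
  have hiU : Integrable (U.indicator fun _ => S) P := (integrable_const S).indicator hU
  have hiO : ∀ k, Integrable ((O k).indicator fun _ => B.gap k) P := fun k =>
    (integrable_const _).indicator (hO k)
  have hiS : Integrable (fun ω => ∑ k, (O k).indicator (fun _ => B.gap k) ω) P :=
    integrable_finsetSum _ fun k _ => hiO k
  calc ∫ ω, B.gap (E (t + 1) ω) ∂P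
      ≤ ∫ ω, (D + (U.indicator (fun _ => S) ω +
          ∑ k, (O k).indicator (fun _ => B.gap k) ω)) ∂P :=
        integral_mono_ae (h.integrable_gap (by omega) htT)
          ((integrable_const D).add (hiU.add hiS)) hpoint
    _ = D + (P.real U * S + ∑ k, P.real (O k) * B.gap k) := by
        have hiUS : Integrable (fun ω => U.indicator (fun _ => S) ω +
          ∑ k, (O k).indicator (fun _ => B.gap k) ω) P := hiU.add hiS
        rw [integral_add (integrable_const D) hiUS, integral_add hiU hiS,
          integral_finsetSum _ fun k _ => hiO k, integral_indicator_const _ hU]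
        simp_rw [integral_indicator_const _ (hO _)]
        simp
    _ ≤ D + (1 / (t : ℝ) ^ 2 * S + ∑ k, 1 / (t : ℝ) ^ 2 * B.gap k) := by
        gcongr with k _
        · exact h.measureReal_underEvent_le hM b ht (by omega)
        · exact B.gap_nonneg k
        · exact h.measureReal_overEvent_le hM k ht (by omega)
    _ = D + 2 * S * (1 / (t : ℝ) ^ 2) := by
        rw [← Finset.mul_sum]; ring

/-- Round `t + 1` is charged to the index `t ≥ 2`. Rounds `1` and `2`, where no concentration is
available, cost at most `∑ gap` each, which is exactly the `t = 1` term of the second sum. -/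
lemma sum_integral_gap_le [IsProbabilityMeasure P] (h : B.IsDUCBRun P ℱ T X R E V)
    (hN : 1 ≤ N) (hfin : ∀ i j : Fin N, B.logDiv i j ≠ ⊤) {n : ℕ} (hn : 1 ≤ n) (hnT : n + 1 ≤ T) :
    ∑ t ∈ Finset.Icc 1 (n + 1), ∫ ω, B.gap (E t ω) ∂P ≤
      ∑ t ∈ Finset.Icc 2 n, activeGap B.orderedGap N (1024 * B.maxM ^ 2 * Real.log T) t +
        2 * (∑ k, B.gap k) * ∑ t ∈ Finset.Icc 1 n, 1 / (t : ℝ) ^ 2 := by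
  induction n, hn using Nat.le_induction with
  | base =>
    have h1 := h.integral_gap_le_sum (t := 1) le_rfl (by omega)
    have h2 := h.integral_gap_le_sum (t := 2) (by omega) (by omega)
    rw [Finset.sum_Icc_succ_top (by omega)]
    simp only [Finset.Icc_self, Finset.sum_singleton, Nat.one_lt_ofNat, Finset.Icc_eq_empty_of_lt,
      Finset.sum_empty, Nat.cast_one, one_pow, div_one, mul_one, zero_add, Nat.reduceAdd]
    linarith
  | succ n hn ih =>
    have h1 := ih (by omega)
    have h2 := h.integral_gap_succ_le hN hfin (t := n + 1) (by omega) hnT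
    rw [Finset.sum_Icc_succ_top (b := n + 1) (by omega),
      Finset.sum_Icc_succ_top (a := 2) (b := n) (by omega),
      Finset.sum_Icc_succ_top (a := 1) (b := n) (f := fun t : ℕ => 1 / (t : ℝ) ^ 2) (by omega),
      mul_add]
    linarith

end IsDUCBRun

end ExpertBandit

theorem theorem1 :
    ∃ C₁ : ℝ, 0 < C₁ ∧
      ∀ (𝒳 : Type*) [MeasurableSpace 𝒳] (K N : ℕ) (_hN : 1 ≤ N) (B : ExpertBandit 𝒳 K N)
        (_hM : ∀ i j : Fin N, B.logDiv i j ≠ ⊤)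
        (Ω : Type*) [mΩ : MeasurableSpace Ω] (P : Measure Ω) [IsProbabilityMeasure P]
        (ℱ : Filtration ℕ mΩ) (T : ℕ) (X : ℕ → Ω → 𝒳) (R : ℕ → Ω → Fin K → unitInterval)
        (E : ℕ → Ω → Fin N) (V : ℕ → Ω → Fin K) (_hrun : B.IsDUCBRun P ℱ T X R E V),
        Integrable (fun ω => B.regret (fun t => E t ω) T) P ∧
        ∫ ω, B.regret (fun t => E t ω) T ∂P ≤
          C₁ * B.maxM ^ 2 * Real.log (6 / B.orderedGap N) ^ 2 * Real.log T / B.orderedGap N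
          + Real.pi ^ 2 / 3 * ∑ i ∈ Finset.Icc 2 N, B.orderedGap i
          + ∑ k ∈ Finset.Icc 2 (N - 1),
              C₁ * B.maxM ^ 2 * Real.log (6 / B.orderedGap k) ^ 2 * Real.log T / B.orderedGap k
                * (1 - gammaFn (B.orderedGap k) / gammaFn (B.orderedGap (k + 1))) := by
  refine ⟨1024, by norm_num, ?_⟩
  intro 𝒳 _ K N hN B hfin Ω mΩ P _ ℱ T X R E V h
  have hint : ∀ t ∈ Finset.Icc 1 T, Integrable (fun ω => B.gap (E t ω)) P := fun t ht =>
    h.integrable_gap (Finset.mem_Icc.1 ht).1 (Finset.mem_Icc.1 ht).2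
  refine ⟨integrable_finsetSum _ hint, ?_⟩
  have hreg : ∫ ω, B.regret (fun t => E t ω) T ∂P =
      ∑ t ∈ Finset.Icc 1 T, ∫ ω, B.gap (E t ω) ∂P := integral_finsetSum _ hint
  rw [hreg, ← B.sum_gap_eq hN]
  set S := ∑ k, B.gap k
  set Q := 1024 * B.maxM ^ 2 * Real.log T with hQdef
  have hQ : 0 ≤ Q := by
    have : 0 ≤ Real.log T := Real.log_natCast_nonneg T
    positivity
  have hS : 0 ≤ S := Finset.sum_nonneg fun k _ => B.gap_nonneg k
  have hmono : ∀ i j, 1 ≤ i → i ≤ j → j ≤ N → B.orderedGap i ≤ B.orderedGap j :=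
    fun i j => B.orderedGap_mono
  have hform : ∀ a : ℝ, 1024 * B.maxM ^ 2 * a * Real.log T = Q * a := fun a => by
    rw [hQdef]; ring
  simp_rw [hform]
  rw [add_right_comm, ← sum_mul_div_gammaFn (B.orderedGap_one hN) hN hmono B.orderedGap_le_one]
  have hmain := fun n => sum_activeGap_le (Q := Q) hQ hmono n
  have hpi : (3 : ℝ) < Real.pi := Real.pi_gt_three
  -- Over the empty range of rounds this says that the main term is nonnegative, as needed for `T ≤
  -- 1`.
  have hmain0 := hmain 0
  simp only [Nat.ofNat_pos, Finset.Icc_eq_empty_of_lt, Finset.sum_empty] at hmain0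
  rcases T with _ | _ | n
  · simp only [Nat.lt_one_iff, Finset.Icc_eq_empty_of_lt, Finset.sum_empty]
    positivity
  · rw [zero_add, Finset.Icc_self, Finset.sum_singleton]
    have h1 := h.integral_gap_le_sum (t := 1) le_rfl (by omega)
    have h2 : 1 * S ≤ Real.pi ^ 2 / 3 * S := by
      gcongr
      nlinarith
    linarith
  · have h1 := h.sum_integral_gap_le hN hfin (n := n + 1) (by omega) le_rfl
    have h2 := sum_one_div_sq_le (n + 1)
    have h3 := hmain (n + 1)
    have h4 : 2 * S * ∑ t ∈ Finset.Icc 1 (n + 1), 1 / (t : ℝ) ^ 2 ≤ 2 * S * (Real.pi ^ 2 / 6) := by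
      gcongr
    linarith
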